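/- Let $2<p<6$. For $I=\mathbb R$ or $I=\mathbb R^+=[0,\infty)$ and real-valued $u\in H^1(I)$ (identified with its continuous representative) let $$E(u,I)=\frac12\int_I|u'|^2\,dx-\frac1p\int_I|u|^p\,dx .$$ For every $\mu>0$ there is exactly one positive and even function $\phi_\mu\in H^1(\mathbb R)$ (the soliton of mass $\mu$) that minimizes $E(\cdot,\mathbb R)$ among all $u\in H^1(\mathbb R)$ with $\int_{\mathbb R}|u|^2\,dx=\mu$. Moreover, for every $a,m>0$ there exist unique $M>0$ and $y\in\mathbb R$ such that $$\phi_M(y)=a\qquad\text{and}\qquad \int_0^{\infty}\phi_M(y+x)^2\,dx=\frac m2 .$$ For these $M$ and $y$, the function $x\mapsto\phi_M(y+x)$ on $\mathbb R^+$ is the unique solution of the problem $$\min E(\phi,\mathbb R^+),\qquad \phi\in H^1(\mathbb R^+),\quad \int_0^\infty|\phi|^2\,dx=\frac m2,\quad \phi(0)=a .$$ Finally, $a>\phi_m(0)$ if and only if $y>0$. -/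

import Mathlib

open MeasureTheory Set

/-- The Sobolev space `H¹(I)` of an interval `I ⊆ ℝ` (here `ℝ` or `[0, ∞)`), in terms of the
continuous representatives: `u` is locally absolutely continuous on `I`, and `u` and its
(almost everywhere defined) derivative, which is the weak derivative of `u`, are in `L²(I)`.
Only the values of `u` on `I` matter. -/
structure MemH1 (I : Set ℝ) (u : ℝ → ℝ) : Prop where
  absolutelyContinuous : ∀ b ∈ I, ∀ c ∈ I, AbsolutelyContinuousOnInterval u b c
  memLp : MemLp u 2 (volume.restrict I)
  memLp_deriv : MemLp (deriv u) 2 (volume.restrict I)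

/-- The mass `∫_I |u|²`. -/
noncomputable def mass (I : Set ℝ) (u : ℝ → ℝ) : ℝ :=
  ∫ x in I, (u x) ^ 2

/-- The NLS energy `E(u, I) = ½ ∫_I |u'|² - (1/p) ∫_I |u|^p`. -/
noncomputable def nlsEnergy (p : ℝ) (I : Set ℝ) (u : ℝ → ℝ) : ℝ :=
  (1 / 2) * (∫ x in I, (deriv u x) ^ 2) - (1 / p) * (∫ x in I, |u x| ^ p)

/-- `f` is a positive and even minimizer of the NLS energy on the real line among all functions
in `H¹(ℝ)` of mass `μ`. -/
structure IsSoliton (p μ : ℝ) (f : ℝ → ℝ) : Prop where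
  memH1 : MemH1 univ f
  mass_eq : mass univ f = μ
  pos : ∀ x, 0 < f x
  even : ∀ x, f (-x) = f x
  minimizes : ∀ u : ℝ → ℝ, MemH1 univ u → mass univ u = μ →
    nlsEnergy p univ f ≤ nlsEnergy p univ u

open Classical in
/-- The soliton `φ_μ`: the positive and even minimizer of the NLS energy on `ℝ` with mass `μ`. -/
noncomputable def soliton (p μ : ℝ) : ℝ → ℝ :=
  if h : ∃ f : ℝ → ℝ, IsSoliton p μ f then h.choose else 0

/-- `v` solves the problem of minimizing the NLS energy on the half-line `[0, ∞)` among the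
functions in `H¹(0, ∞)` of mass `ν` with the value `a` at `0`. -/
structure IsHalfLineMinimizer (p ν a : ℝ) (v : ℝ → ℝ) : Prop where
  memH1 : MemH1 (Ici 0) v
  mass_eq : mass (Ici 0) v = ν
  dirichlet : v 0 = a
  minimizes : ∀ u : ℝ → ℝ, MemH1 (Ici 0) u → mass (Ici 0) u = ν → u 0 = a →
    nlsEnergy p (Ici 0) v ≤ nlsEnergy p (Ici 0) u

/-! Let w_κ be the explicit wave of frequency κ², A_κ its height, T_κ(y) its mass beyond y, g_κ =
`waveSlope` and G_κ its primitive. Completing the square, with |u| ≤ A_κ on the half-line, E(u) +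
(κ²/2)∫u² = ½∫(|u'| − g_κ(u))² + ∫ g_κ(u)|u'|. The last integral bounds the variation of G_κ(u), so
it is at least G_κ(|u(0)|) and at least 2G_κ(|u(x₀)|) − G_κ(|u(0)|) for every x₀ ≥ 0. Translates
w_κ(y + ·) attain the first bound if y ≥ 0, and the second at their peak if y ≤ 0.

A competitor v may exceed A_κ. Unless y > 0 and |v| ≤ A_κ, it is calibrated with the frequency κ'
for which A_κ' = max |v|. To return to κ, a virial identity and scaling give G_κ(A_κ) = c(κ²)^β with
β = (p+2)/(2(p−2)), and β > 1 because p < 6. Strict convexity in κ² yields a tangent line inequality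
of slope T_κ(0)/2 (`slopePrimitive_waveHeight_lt`). Testing the action of frequency κ' on w_κ bounds
G_κ' at the boundary value (`slopePrimitive_wave_le`). The terms in κ'² − κ² then cancel or help
(`nlsEnergy_wave_le`).

Equality forces |v| ≤ A_κ and |v'| = g_κ(v) almost everywhere. This alone does not determine v,
which may rest at height A_κ, where g_κ vanishes without being Lipschitz. A one-sided Lipschitz
bound still puts v above a translated wave (`MemH1.wave_le`), and equality of masses makes the two
coincide.

Uniqueness of (M, y) follows from uniqueness of the minimizer. By scaling, existence and the sign of
y reduce to one function of z = κy, `scaledMass`, which decreases from ∞ to 0. -/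

open Filter Topology

/-! ### Absolutely continuous functions: composition and reflection -/

namespace AbsolutelyContinuousOnInterval

lemma congr_of_eqOn {f g : ℝ → ℝ} {a b : ℝ} (hf : AbsolutelyContinuousOnInterval f a b)
    (h : EqOn f g (uIcc a b)) : AbsolutelyContinuousOnInterval g a b := by
  rw [absolutelyContinuousOnInterval_iff] at hf ⊢
  intro ε hε
  obtain ⟨δ, hδ, H⟩ := hf ε hε
  refine ⟨δ, hδ, fun E hE hl => ?_⟩
  refine lt_of_eq_of_lt (Finset.sum_congr rfl fun i hi => ?_) (H E hE hl)
  rw [h (hE.1 i hi).1, h (hE.1 i hi).2]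

lemma comp_of_lipschitzOnWith {f g : ℝ → ℝ} {a b : ℝ} {K : NNReal} {s : Set ℝ}
    (hf : AbsolutelyContinuousOnInterval f a b) (hg : LipschitzOnWith K g s)
    (hs : MapsTo f (uIcc a b) s) : AbsolutelyContinuousOnInterval (fun x => g (f x)) a b := by
  rw [absolutelyContinuousOnInterval_iff] at hf ⊢
  intro ε hε
  obtain ⟨δ, hδ, H⟩ := hf (ε / (K + 1)) (by positivity)
  refine ⟨δ, hδ, fun E hE hl => ?_⟩
  have h1 := H E hE hl
  calc _ ≤ ∑ i ∈ Finset.range E.1, (K : ℝ) * dist (f (E.2 i).1) (f (E.2 i).2) :=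
        Finset.sum_le_sum fun i hi =>
          hg.dist_le_mul _ (hs (hE.1 i hi).1) _ (hs (hE.1 i hi).2)
    _ = K * ∑ i ∈ Finset.range E.1, dist (f (E.2 i).1) (f (E.2 i).2) := by rw [Finset.mul_sum]
    _ ≤ K * (ε / (K + 1)) := by gcongr
    _ < (K + 1) * (ε / (K + 1)) := by gcongr; linarith
    _ = ε := by field_simp

lemma comp_contDiff {f g : ℝ → ℝ} {a b : ℝ} (hf : AbsolutelyContinuousOnInterval f a b)
    (hg : ContDiff ℝ 1 g) : AbsolutelyContinuousOnInterval (fun x => g (f x)) a b := by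
  obtain ⟨C, hC⟩ := hf.exists_bound
  obtain ⟨K, hK⟩ := (hg.contDiffOn (s := Icc (-C) C)).exists_lipschitzOnWith (by decide)
    (convex_Icc _ _) isCompact_Icc
  exact hf.comp_of_lipschitzOnWith hK fun x hx => abs_le.1 (hC x hx)

lemma comp_neg {f : ℝ → ℝ} {a b : ℝ} (hf : AbsolutelyContinuousOnInterval f a b) :
    AbsolutelyContinuousOnInterval (fun x => f (-x)) (-a) (-b) := by
  have hi : IntervalIntegrable (fun t => -deriv f (-t)) volume (-a) (-b) := by
    have := (IntervalIntegrable.iff_comp_neg (f := deriv f) (a := a) (b := b)).1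
      hf.intervalIntegrable_deriv
    exact this.neg
  -- f(−x) is f(a) plus a primitive of −f'(−t); the constant is added by composing with a
  -- translation.
  have h0 : LipschitzOnWith 1 (fun y : ℝ => f a + y) univ :=
    LipschitzOnWith.of_dist_le_mul fun x _ y _ => by simp
  refine ((hi.absolutelyContinuousOnInterval_intervalIntegral
    left_mem_uIcc).comp_of_lipschitzOnWith h0 (mapsTo_univ _ _)).congr_of_eqOn fun x hx => ?_
  have hx' : -x ∈ uIcc a b := by
    rw [mem_uIcc] at hx ⊢
    rcases hx with h | h
    · right; constructor <;> linarith [h.1, h.2]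
    · left; constructor <;> linarith [h.1, h.2]
  have h1 := (hf.mono (c := a) (d := -x)
    (uIcc_subset_uIcc left_mem_uIcc hx')).integral_deriv_eq_sub
  have h2 := intervalIntegral.integral_comp_neg (a := -a) (b := x) (f := deriv f)
  rw [neg_neg] at h2
  simp only [intervalIntegral.integral_neg, h2]
  rw [intervalIntegral.integral_symm, neg_neg, h1]; ring

end AbsolutelyContinuousOnInterval

/-! ### H¹ on the half-line: decay, attained maximum, integrability -/

lemma MemH1.mono {I J : Set ℝ} {u : ℝ → ℝ} (h : MemH1 J u) (hIJ : I ⊆ J) : MemH1 I u :=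
  ⟨fun b hb c hc => h.1 b (hIJ hb) c (hIJ hc),
    h.2.mono_measure (Measure.restrict_mono hIJ le_rfl),
    h.3.mono_measure (Measure.restrict_mono hIJ le_rfl)⟩

lemma deriv_reflect (u : ℝ → ℝ) : deriv (fun x => u (-x)) = fun x => -deriv u (-x) := by
  funext x; exact deriv_comp_neg u x

lemma MemH1.reflect {u : ℝ → ℝ} (h : MemH1 univ u) : MemH1 univ fun x => u (-x) := by
  refine ⟨fun b _ c _ => ?_, ?_, ?_⟩
  · simpa using (h.1 (-b) trivial (-c) trivial).comp_neg
  · have h2 := h.2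
    rw [Measure.restrict_univ] at h2 ⊢
    exact h2.comp_measurePreserving (Measure.measurePreserving_neg volume)
  · have h2 := h.3
    rw [Measure.restrict_univ] at h2 ⊢
    rw [deriv_reflect]
    exact (h2.comp_measurePreserving (Measure.measurePreserving_neg volume)).neg

namespace MemH1

variable {u : ℝ → ℝ}

lemma continuousOn (h : MemH1 (Ici 0) u) : ContinuousOn u (Ici 0) := by
  intro x hx
  have h1 := (h.1 0 self_mem_Ici (x + 1) (by simp only [mem_Ici] at hx ⊢; linarith)).continuousOn
  have hx0 : (0 : ℝ) ≤ x := hx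
  rw [uIcc_of_le (by linarith)] at h1
  refine (h1 x ⟨hx0, by linarith⟩).mono_of_mem_nhdsWithin ?_
  refine mem_of_superset (inter_mem_nhdsWithin _ (Iio_mem_nhds (show x < x + 1 by linarith))) ?_
  exact fun y hy => ⟨hy.1, le_of_lt hy.2⟩

lemma integrableOn_sq (h : MemH1 (Ici 0) u) : IntegrableOn (fun x => u x ^ 2) (Ioi 0) := by
  have h1 : IntegrableOn (fun x => u x ^ 2) (Ici 0) := h.2.integrable_sq
  exact h1.mono_set Ioi_subset_Ici_self

lemma integrableOn_deriv_sq (h : MemH1 (Ici 0) u) :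
    IntegrableOn (fun x => deriv u x ^ 2) (Ioi 0) := by
  have h1 : IntegrableOn (fun x => deriv u x ^ 2) (Ici 0) := h.3.integrable_sq
  exact h1.mono_set Ioi_subset_Ici_self

lemma aestronglyMeasurable (h : MemH1 (Ici 0) u) :
    AEStronglyMeasurable u (volume.restrict (Ioi 0)) :=
  h.2.1.mono_measure (Measure.restrict_mono Ioi_subset_Ici_self le_rfl)

lemma integrableOn_mul_deriv (h : MemH1 (Ici 0) u) :
    IntegrableOn (fun x => u x * deriv u x) (Ioi 0) := by
  have h1 : IntegrableOn (fun x => u x * deriv u x) (Ici 0) := h.2.integrable_mul h.3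
  exact h1.mono_set Ioi_subset_Ici_self

lemma ae_differentiableAt (h : MemH1 (Ici 0) u) :
    ∀ᵐ x, x ∈ Ioi (0 : ℝ) → DifferentiableAt ℝ u x := by
  have h1 : ∀ n : ℕ, ∀ᵐ x, x ∈ uIcc (0 : ℝ) n → DifferentiableAt ℝ u x := fun n =>
    (h.1 0 self_mem_Ici n (mem_Ici.2 (Nat.cast_nonneg n))).ae_differentiableAt
  filter_upwards [ae_all_iff.2 h1] with x hx hx0
  obtain ⟨n, hn⟩ := exists_nat_ge x
  exact hx n (by rw [uIcc_of_le (Nat.cast_nonneg n)]; exact ⟨le_of_lt hx0, hn⟩)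

end MemH1

lemma AbsolutelyContinuousOnInterval.integral_comp_mul_deriv {u Ψ : ℝ → ℝ} {a b : ℝ}
    (hu : AbsolutelyContinuousOnInterval u a b) (hΨ : ContDiff ℝ 1 Ψ) :
    ∫ x in a..b, deriv Ψ (u x) * deriv u x = Ψ (u b) - Ψ (u a) := by
  rw [← (hu.comp_contDiff hΨ).integral_deriv_eq_sub]
  refine intervalIntegral.integral_congr_ae ?_
  filter_upwards [hu.ae_differentiableAt] with x hx hx'
  have hd := hx (uIoc_subset_uIcc hx')
  exact ((hΨ.differentiable one_ne_zero (u x)).hasDerivAt.comp x hd.hasDerivAt).deriv.symm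

namespace MemH1

variable {u : ℝ → ℝ}

/-- Since u u' is integrable, u² has a limit, which integrability of u² forces to be 0. -/
lemma tendsto_atTop (h : MemH1 (Ici 0) u) : Tendsto u atTop (𝓝 0) := by
  have h1 := intervalIntegral_tendsto_integral_Ioi 0
    (h.integrableOn_mul_deriv.const_mul 2) tendsto_id
  have h2 : Tendsto (fun x => u x ^ 2) atTop
      (𝓝 (u 0 ^ 2 + ∫ x in Ioi (0 : ℝ), 2 * (u x * deriv u x))) := by
    refine (h1.const_add (u 0 ^ 2)).congr' ?_
    filter_upwards [eventually_ge_atTop 0] with x hx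
    have := (h.1 0 self_mem_Ici x hx).integral_comp_mul_deriv
      (Ψ := fun s => s ^ 2) (by fun_prop)
    rw [id, ← eq_sub_iff_add_eq', ← this]
    refine intervalIntegral.integral_congr fun t _ => ?_
    simp [mul_assoc]
  have h3 := IntegrableAtFilter.eq_zero_of_tendsto ⟨_, Ioi_mem_atTop 0, h.integrableOn_sq⟩
    (fun s hs => by
      obtain ⟨c, hc⟩ := mem_atTop_sets.1 hs
      exact measure_mono_top (fun y hy => hc y hy : Ici c ⊆ s) Real.volume_Ici) h2
  rw [h3] at h2
  have h4 := h2.sqrt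
  simp only [Real.sqrt_sq_eq_abs, Real.sqrt_zero] at h4
  exact (tendsto_zero_iff_abs_tendsto_zero u).2 h4

/-- Decay reduces the maximum to a compact interval. Its value later selects the frequency of the
calibrating wave. -/
lemma exists_forall_abs_le (h : MemH1 (Ici 0) u) :
    ∃ x₀, 0 ≤ x₀ ∧ ∀ x, 0 ≤ x → |u x| ≤ |u x₀| := by
  by_cases h0 : ∃ x₁, 0 ≤ x₁ ∧ u x₁ ≠ 0
  · obtain ⟨x₁, hx₁, h1⟩ := h0
    have h2 : ∀ᶠ x in atTop, |u x| < |u x₁| := by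
      have := h.tendsto_atTop.abs
      rw [abs_zero] at this
      exact this.eventually_lt_const (abs_pos.2 h1)
    obtain ⟨c, hc⟩ := eventually_atTop.1 h2
    have hc0 : (0 : ℝ) ≤ max c x₁ := le_max_of_le_right hx₁
    obtain ⟨x₀, hx₀, hm⟩ := isCompact_Icc.exists_isMaxOn (nonempty_Icc.2 hc0)
      (h.continuousOn.mono (fun x hx => hx.1 : Icc 0 (max c x₁) ⊆ Ici 0)).abs
    refine ⟨x₀, hx₀.1, fun x hx => ?_⟩
    rcases le_total x (max c x₁) with hxc | hxc
    · exact hm ⟨hx, hxc⟩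
    · exact (hc x ((le_max_left _ _).trans hxc)).le.trans (hm ⟨hx₁, le_max_right _ _⟩)
  · push Not at h0
    exact ⟨0, le_rfl, fun x hx => by simp [h0 x hx]⟩

lemma integrableOn_rpow {p : ℝ} (hp : 2 < p) (h : MemH1 (Ici 0) u) :
    IntegrableOn (fun x => |u x| ^ p) (Ioi 0) := by
  obtain ⟨x₀, -, hm⟩ := h.exists_forall_abs_le
  refine (h.integrableOn_sq.const_mul (|u x₀| ^ (p - 2))).mono' ?_ ?_
  · exact ((measurable_id.pow_const p).comp measurable_id.abs).comp_aemeasurable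
      h.aestronglyMeasurable.aemeasurable |>.aestronglyMeasurable
  · refine (ae_restrict_mem measurableSet_Ioi).mono fun x hx => ?_
    have h1 : |u x| ^ p = |u x| ^ (p - 2) * u x ^ 2 := by
      rw [← sq_abs (u x), ← Real.rpow_natCast, ← Real.rpow_add_of_nonneg (abs_nonneg _)
        (by linarith) (by norm_num)]
      congr 1; push_cast; ring
    rw [Real.norm_of_nonneg (by positivity), h1]
    have := hm x (le_of_lt hx)
    gcongr

end MemH1

/-- The height of the standing wave of frequency `κ²`. -/
noncomputable def waveHeight (p κ : ℝ) : ℝ := (p * κ ^ 2 / 2) ^ (1 / (p - 2))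

/-- The standing wave of frequency `κ²`. -/
noncomputable def wave (p κ x : ℝ) : ℝ :=
  waveHeight p κ * Real.cosh ((p - 2) / 2 * κ * x) ^ (-(2 / (p - 2)))

/-- The slope `√(κ² s² - (2/p) |s|^p)` of the standing wave at height `s`. -/
noncomputable def waveSlope (p κ s : ℝ) : ℝ := √(κ ^ 2 * s ^ 2 - 2 / p * |s| ^ p)

/-! ### The explicit standing waves -/

section wave

variable {p κ : ℝ}

lemma waveHeight_pos (hp : 2 < p) (hκ : 0 < κ) : 0 < waveHeight p κ := by
  unfold waveHeight; positivity

lemma waveHeight_rpow (hp : 2 < p) (hκ : 0 < κ) : waveHeight p κ ^ (p - 2) = p * κ ^ 2 / 2 := by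
  have : p - 2 ≠ 0 := by linarith
  rw [waveHeight, ← Real.rpow_mul (by positivity), one_div_mul_cancel this, Real.rpow_one]

lemma waveHeight_strictMono (hp : 2 < p) {κ κ' : ℝ} (hκ : 0 < κ) (h : κ < κ') :
    waveHeight p κ < waveHeight p κ' := by
  unfold waveHeight
  have : 0 < p - 2 := by linarith
  refine Real.rpow_lt_rpow (by positivity) ?_ (by positivity)
  have : κ ^ 2 < κ' ^ 2 := by gcongr
  have : 0 < p := by linarith
  gcongr

lemma exists_waveHeight_eq (hp : 2 < p) {A : ℝ} (hA : 0 < A) : ∃ κ, 0 < κ ∧ waveHeight p κ = A := by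
  have hp0 : 0 < p := by linarith
  have h2 : p - 2 ≠ 0 := by linarith
  refine ⟨√(2 / p * A ^ (p - 2)), by positivity, ?_⟩
  rw [waveHeight, Real.sq_sqrt (by positivity)]
  rw [show p * (2 / p * A ^ (p - 2)) / 2 = A ^ (p - 2) by field_simp, ← Real.rpow_mul hA.le,
    mul_one_div_cancel h2, Real.rpow_one]

lemma wave_pos (hp : 2 < p) (hκ : 0 < κ) (x : ℝ) : 0 < wave p κ x :=
  mul_pos (waveHeight_pos hp hκ) (Real.rpow_pos_of_pos (Real.cosh_pos _) _)

lemma wave_neg (p κ x : ℝ) : wave p κ (-x) = wave p κ x := by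
  simp [wave]

lemma wave_abs (p κ x : ℝ) : wave p κ |x| = wave p κ x := by
  rcases abs_choice x with h | h <;> rw [h]
  exact wave_neg p κ x

lemma wave_zero (p κ : ℝ) : wave p κ 0 = waveHeight p κ := by simp [wave]

lemma wave_strictAntiOn (hp : 2 < p) (hκ : 0 < κ) : StrictAntiOn (wave p κ) (Ici 0) := by
  intro x hx y hy hxy
  have hp2 : 0 < p - 2 := by linarith
  have hx0 : (0 : ℝ) ≤ x := hx
  refine mul_lt_mul_of_pos_left ?_ (waveHeight_pos hp hκ)
  refine Real.rpow_lt_rpow_of_neg (Real.cosh_pos _) ?_ (neg_neg_of_pos (by positivity))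
  rw [Real.cosh_lt_cosh, abs_of_nonneg (by positivity),
    abs_of_nonneg (mul_nonneg (by positivity) hy)]
  gcongr

lemma wave_lt_wave_iff (hp : 2 < p) (hκ : 0 < κ) {x y : ℝ} :
    wave p κ x < wave p κ y ↔ |y| < |x| := by
  rw [← wave_abs p κ x, ← wave_abs p κ y]
  exact (wave_strictAntiOn hp hκ).lt_iff_gt (abs_nonneg x) (abs_nonneg y)

lemma wave_le_wave_iff (hp : 2 < p) (hκ : 0 < κ) {x y : ℝ} :
    wave p κ x ≤ wave p κ y ↔ |y| ≤ |x| := by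
  rw [← not_lt, wave_lt_wave_iff hp hκ, not_lt]

lemma wave_le_waveHeight (hp : 2 < p) (hκ : 0 < κ) (x : ℝ) : wave p κ x ≤ waveHeight p κ := by
  rw [← wave_zero, wave_le_wave_iff hp hκ]; simp

lemma hasDerivAt_wave (hp : 2 < p) (x : ℝ) :
    HasDerivAt (wave p κ) (-κ * wave p κ x * Real.tanh ((p - 2) / 2 * κ * x)) x := by
  have hc := Real.cosh_pos ((p - 2) / 2 * κ * x)
  have h1 : HasDerivAt (fun x => (p - 2) / 2 * κ * x) ((p - 2) / 2 * κ) x := by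
    simpa using (hasDerivAt_id x).const_mul ((p - 2) / 2 * κ)
  have h2 := ((h1.cosh).rpow_const (p := -(2 / (p - 2))) (Or.inl hc.ne')).const_mul
    (waveHeight p κ)
  refine h2.congr_deriv ?_
  have : p - 2 ≠ 0 := by linarith
  rw [wave, Real.tanh_eq_sinh_div_cosh, Real.rpow_sub_one hc.ne']
  field_simp

lemma deriv_wave (hp : 2 < p) (x : ℝ) :
    deriv (wave p κ) x = -κ * wave p κ x * Real.tanh ((p - 2) / 2 * κ * x) :=
  (hasDerivAt_wave hp x).deriv

lemma contDiff_wave (p κ : ℝ) : ContDiff ℝ 1 (wave p κ) := by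
  unfold wave
  refine contDiff_const.mul (ContDiff.rpow_const_of_ne ?_ fun x => (Real.cosh_pos _).ne')
  exact Real.contDiff_cosh.comp (by fun_prop)

lemma continuous_wave (p κ : ℝ) : Continuous (wave p κ) := (contDiff_wave p κ).continuous

/-- The first integral of w'' = κ²w − w^(p−1), at the level 0 fixed by decay at infinity. -/
lemma sq_sub_wave (hp : 2 < p) (hκ : 0 < κ) (x : ℝ) :
    κ ^ 2 * wave p κ x ^ 2 - 2 / p * |wave p κ x| ^ p = deriv (wave p κ) x ^ 2 := by
  have hc := Real.cosh_pos ((p - 2) / 2 * κ * x)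
  have hw := wave_pos hp hκ x
  have hp2 : p - 2 ≠ 0 := by linarith
  have hp0 : p ≠ 0 := by linarith
  have h1 : wave p κ x ^ (p - 2) = p * κ ^ 2 / 2 * (1 / Real.cosh ((p - 2) / 2 * κ * x) ^ 2) := by
    rw [wave, Real.mul_rpow (waveHeight_pos hp hκ).le (by positivity), waveHeight_rpow hp hκ,
      ← Real.rpow_mul hc.le, show -(2 / (p - 2)) * (p - 2) = -(2 : ℕ) by field_simp; norm_num,
      Real.rpow_neg hc.le, Real.rpow_natCast, one_div]
  have h2 : wave p κ x ^ p = wave p κ x ^ (p - 2) * wave p κ x ^ 2 := by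
    rw [← Real.rpow_natCast, ← Real.rpow_add hw]
    congr 1; push_cast; ring
  rw [abs_of_pos hw, h2, h1, deriv_wave hp, Real.tanh_eq_sinh_div_cosh]
  field_simp
  rw [Real.cosh_sq]; ring

lemma waveSlope_wave (hp : 2 < p) (hκ : 0 < κ) (x : ℝ) :
    waveSlope p κ (wave p κ x) = |deriv (wave p κ) x| := by
  rw [waveSlope, sq_sub_wave hp hκ, Real.sqrt_sq_eq_abs]

lemma deriv_wave_nonpos (hp : 2 < p) (hκ : 0 < κ) {x : ℝ} (hx : 0 ≤ x) :
    deriv (wave p κ) x ≤ 0 := by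
  have hw := wave_pos hp hκ x
  have hp2 : 0 < p - 2 := by linarith
  rw [deriv_wave hp, Real.tanh_eq_sinh_div_cosh]
  have : 0 ≤ Real.sinh ((p - 2) / 2 * κ * x) := Real.sinh_nonneg_iff.2 (by positivity)
  have := div_nonneg this (Real.cosh_pos ((p - 2) / 2 * κ * x)).le
  nlinarith [mul_nonneg (mul_pos hκ hw).le this]

lemma abs_deriv_wave_le (hp : 2 < p) (hκ : 0 < κ) (x : ℝ) :
    |deriv (wave p κ) x| ≤ κ * wave p κ x := by
  have hw := wave_pos hp hκ x
  have h := sq_sub_wave hp hκ x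
  have : 0 ≤ 2 / p * |wave p κ x| ^ p := by positivity
  refine abs_le_of_sq_le_sq (by nlinarith) (by positivity)

lemma wave_eq_scale (hp : 2 < p) (hκ : 0 < κ) (x : ℝ) :
    wave p κ x = κ ^ (2 / (p - 2)) * wave p 1 (κ * x) := by
  have hp0 : 0 < p := by linarith
  have h1 : waveHeight p κ = κ ^ (2 / (p - 2)) * waveHeight p 1 := by
    rw [waveHeight, waveHeight, show p * κ ^ 2 / 2 = κ ^ 2 * (p * 1 ^ 2 / 2) by ring,
      Real.mul_rpow (by positivity) (by positivity), ← Real.rpow_natCast κ 2,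
      ← Real.rpow_mul hκ.le]
    congr 2; push_cast; ring
  rw [wave, wave, h1, mul_assoc, mul_one, mul_assoc ((p - 2) / 2)]

lemma exists_wave_le_exp (hp : 2 < p) (hκ : 0 < κ) :
    ∃ C, 0 ≤ C ∧ ∀ x, wave p κ x ≤ C * Real.exp (-κ * |x|) := by
  have hp2 : 0 < p - 2 := by linarith
  refine ⟨waveHeight p κ * (1 / 2 : ℝ) ^ (-(2 / (p - 2))),
    mul_nonneg (waveHeight_pos hp hκ).le (by positivity), fun x => ?_⟩
  rw [← wave_abs, wave, mul_assoc (waveHeight p κ)]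
  refine mul_le_mul_of_nonneg_left ?_ (waveHeight_pos hp hκ).le
  set t := (p - 2) / 2 * κ * |x| with ht
  have h1 : 1 / 2 * Real.exp t ≤ Real.cosh t := by
    rw [Real.cosh_eq]; linarith [Real.exp_pos (-t)]
  calc Real.cosh t ^ (-(2 / (p - 2))) ≤ (1 / 2 * Real.exp t) ^ (-(2 / (p - 2))) :=
        Real.rpow_le_rpow_of_nonpos (by positivity) h1 (neg_nonpos.2 (by positivity))
    _ = _ := by
      rw [Real.mul_rpow (by norm_num) (Real.exp_pos _).le, ← Real.exp_mul, ht]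
      congr 2; field_simp

lemma tendsto_wave (hp : 2 < p) (hκ : 0 < κ) : Tendsto (wave p κ) atTop (𝓝 0) := by
  obtain ⟨C, hC, h⟩ := exists_wave_le_exp hp hκ
  refine squeeze_zero (fun x => (wave_pos hp hκ x).le) h ?_
  have : Tendsto (fun x : ℝ => Real.exp (-κ * |x|)) atTop (𝓝 0) := by
    refine Real.tendsto_exp_atBot.comp ?_
    exact tendsto_abs_atTop_atTop.const_mul_atTop_of_neg (by linarith)
  simpa using this.const_mul C

lemma integrable_wave_rpow (hp : 2 < p) (hκ : 0 < κ) {r : ℝ} (hr : 0 < r) :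
    Integrable fun x => wave p κ x ^ r := by
  obtain ⟨C, hC, h⟩ := exists_wave_le_exp hp hκ
  have h2 : Integrable (fun x : ℝ => Real.exp (-(κ * r) * |x|)) := by
    refine Integrable.of_integral_ne_zero ?_
    rw [integral_comp_abs (f := fun x => Real.exp (-(κ * r) * x)),
      integral_exp_mul_Ioi (by nlinarith [mul_pos hκ hr]) 0]
    have := mul_pos hκ hr
    simp [hκ.ne', hr.ne']
  refine (h2.const_mul (C ^ r)).mono' ?_ (Eventually.of_forall fun x => ?_)
  · exact ((continuous_wave p κ).rpow_const fun x => Or.inl (wave_pos hp hκ x).ne').aestronglyMeasurable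
  · have hw := wave_pos hp hκ x
    rw [Real.norm_of_nonneg (by positivity)]
    calc wave p κ x ^ r ≤ (C * Real.exp (-κ * |x|)) ^ r := by gcongr; exact h x
      _ = _ := by
        rw [Real.mul_rpow hC (Real.exp_pos _).le, ← Real.exp_mul]; ring_nf

lemma integrable_wave_sq (hp : 2 < p) (hκ : 0 < κ) : Integrable fun x => wave p κ x ^ 2 := by
  simpa using integrable_wave_rpow hp hκ (r := 2) (by norm_num)

lemma memH1_wave (hp : 2 < p) (hκ : 0 < κ) (y : ℝ) : MemH1 univ fun x => wave p κ (y + x) := by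
  have hi := integrable_wave_sq hp hκ
  have hm : MemLp (wave p κ) 2 volume :=
    (memLp_two_iff_integrable_sq (continuous_wave p κ).aestronglyMeasurable).2 hi
  have hd : MemLp (deriv (wave p κ)) 2 volume := by
    refine (hm.const_mul κ).mono (measurable_deriv _).aestronglyMeasurable
      (Eventually.of_forall fun x => ?_)
    rw [Real.norm_eq_abs, Real.norm_of_nonneg (mul_nonneg hκ.le (wave_pos hp hκ x).le)]
    exact abs_deriv_wave_le hp hκ x
  refine ⟨fun b _ c _ => ContDiffOn.absolutelyContinuousOnInterval
    (((contDiff_wave p κ).comp (by fun_prop)).contDiffOn), ?_, ?_⟩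
  · rw [Measure.restrict_univ]
    exact hm.comp_measurePreserving (measurePreserving_add_left volume y)
  · rw [Measure.restrict_univ]
    have : deriv (fun x => wave p κ (y + x)) = fun x => deriv (wave p κ) (y + x) := by
      funext x; exact deriv_comp_const_add _ _ _
    rw [this]
    exact hd.comp_measurePreserving (measurePreserving_add_left volume y)

end wave

/-- The primitive of `waveSlope` that vanishes at `0`. -/
noncomputable def slopePrimitive (p κ s : ℝ) : ℝ := ∫ t in (0 : ℝ)..s, waveSlope p κ t

/-- The action `E(u, ℝ⁺) + (κ²/2) ∫_0^∞ u²` on the half-line. -/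
noncomputable def halfAction (p κ : ℝ) (u : ℝ → ℝ) : ℝ :=
  nlsEnergy p (Ici 0) u + κ ^ 2 / 2 * mass (Ici 0) u

/-- The defect of `u` in the equation `|u'| = √(κ² u² - (2/p) |u|^p)`. -/
noncomputable def slopeDefect (p κ : ℝ) (u : ℝ → ℝ) : ℝ :=
  ∫ x in Ioi (0 : ℝ), (|deriv u x| - waveSlope p κ (u x)) ^ 2

/-! ### Completing the square in the action -/

section slope

variable {p κ : ℝ}

lemma continuous_waveSlope (hp : 2 < p) : Continuous (waveSlope p κ) := by
  unfold waveSlope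
  have : Continuous fun s : ℝ => |s| ^ p :=
    continuous_abs.rpow_const fun x => Or.inr (by linarith)
  fun_prop

lemma waveSlope_nonneg (s : ℝ) : 0 ≤ waveSlope p κ s := Real.sqrt_nonneg _

lemma waveSlope_neg (s : ℝ) : waveSlope p κ (-s) = waveSlope p κ s := by
  simp [waveSlope]

lemma waveSlope_le (hp : 2 < p) (hκ : 0 < κ) (s : ℝ) : waveSlope p κ s ≤ κ * |s| := by
  refine Real.sqrt_le_iff.2 ⟨by positivity, ?_⟩
  have : 0 ≤ 2 / p * |s| ^ p := by positivity
  rw [mul_pow, sq_abs]; linarith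

lemma abs_rpow_eq_mul (hp : 2 < p) (s : ℝ) : |s| ^ p = |s| ^ (p - 2) * s ^ 2 := by
  rw [← sq_abs s, ← Real.rpow_natCast, ← Real.rpow_add_of_nonneg (abs_nonneg _)
    (by linarith) (by norm_num)]
  congr 1; push_cast; ring

/-- The radicand is nonnegative exactly up to the wave height; above it the real square root returns
0 and the identity fails. -/
lemma waveSlope_sq (hp : 2 < p) (hκ : 0 < κ) {s : ℝ} (hs : |s| ≤ waveHeight p κ) :
    waveSlope p κ s ^ 2 = κ ^ 2 * s ^ 2 - 2 / p * |s| ^ p := by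
  refine Real.sq_sqrt ?_
  have h1 : |s| ^ (p - 2) ≤ waveHeight p κ ^ (p - 2) :=
    Real.rpow_le_rpow (abs_nonneg s) hs (by linarith)
  rw [waveHeight_rpow hp hκ] at h1
  rw [abs_rpow_eq_mul hp]
  have hp0 : 0 < p := by linarith
  have h2 : 2 / p * |s| ^ (p - 2) ≤ κ ^ 2 := by
    calc 2 / p * |s| ^ (p - 2) ≤ 2 / p * (p * κ ^ 2 / 2) := by gcongr
      _ = κ ^ 2 := by field_simp
  nlinarith [mul_le_mul_of_nonneg_right h2 (sq_nonneg s)]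

lemma hasDerivAt_slopePrimitive (hp : 2 < p) (s : ℝ) :
    HasDerivAt (slopePrimitive p κ) (waveSlope p κ s) s :=
  ((continuous_waveSlope hp).integral_hasStrictDerivAt 0 s).hasDerivAt

lemma deriv_slopePrimitive (hp : 2 < p) : deriv (slopePrimitive p κ) = waveSlope p κ :=
  funext fun s => (hasDerivAt_slopePrimitive hp s).deriv

lemma contDiff_slopePrimitive (hp : 2 < p) : ContDiff ℝ 1 (slopePrimitive p κ) := by
  rw [contDiff_one_iff_deriv, deriv_slopePrimitive hp]
  exact ⟨fun s => (hasDerivAt_slopePrimitive hp s).differentiableAt, continuous_waveSlope hp⟩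

lemma slopePrimitive_zero : slopePrimitive p κ 0 = 0 := by simp [slopePrimitive]

lemma slopePrimitive_neg (s : ℝ) : slopePrimitive p κ (-s) = -slopePrimitive p κ s := by
  have h := intervalIntegral.integral_comp_neg (a := 0) (b := s) (f := waveSlope p κ)
  simp only [waveSlope_neg, neg_zero] at h
  rw [slopePrimitive, slopePrimitive, intervalIntegral.integral_symm, ← h]

lemma slopePrimitive_mono (hp : 2 < p) : Monotone (slopePrimitive p κ) :=
  monotone_of_deriv_nonneg (contDiff_slopePrimitive hp |>.differentiable one_ne_zero) fun s => by
    rw [deriv_slopePrimitive hp]; exact waveSlope_nonneg s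

lemma slopePrimitive_nonneg (hp : 2 < p) {s : ℝ} (hs : 0 ≤ s) : 0 ≤ slopePrimitive p κ s := by
  simpa [slopePrimitive_zero] using slopePrimitive_mono (κ := κ) hp hs

lemma slopePrimitive_abs (hp : 2 < p) (s : ℝ) :
    slopePrimitive p κ |s| = |slopePrimitive p κ s| := by
  rcases le_total 0 s with h | h
  · rw [abs_of_nonneg h, abs_of_nonneg (slopePrimitive_nonneg hp h)]
  · have := slopePrimitive_nonneg (κ := κ) hp (neg_nonneg.2 h)
    rw [slopePrimitive_neg] at this
    rw [abs_of_nonpos h, slopePrimitive_neg, abs_of_nonpos (by linarith)]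

variable {u : ℝ → ℝ}

lemma integrableOn_waveSlope_mul (hp : 2 < p) (hκ : 0 < κ) (hu : MemH1 (Ici 0) u) :
    IntegrableOn (fun x => waveSlope p κ (u x) * |deriv u x|) (Ioi 0) := by
  refine (hu.integrableOn_mul_deriv.norm.const_mul κ).mono' ?_ (Eventually.of_forall fun x => ?_)
  · exact ((continuous_waveSlope hp).comp_aestronglyMeasurable hu.aestronglyMeasurable).mul
      (measurable_deriv u).norm.aestronglyMeasurable
  · rw [Real.norm_of_nonneg (mul_nonneg (waveSlope_nonneg _) (abs_nonneg _)), norm_mul,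
      ← mul_assoc]
    exact mul_le_mul_of_nonneg_right (waveSlope_le hp hκ _) (abs_nonneg _)

/-- Expand (|u'| − g(u))²; the bound on |u| turns g(u)² back into the potential terms. -/
lemma halfAction_eq (hp : 2 < p) (hκ : 0 < κ) (hu : MemH1 (Ici 0) u)
    (hb : ∀ x, 0 ≤ x → |u x| ≤ waveHeight p κ) :
    halfAction p κ u = 1 / 2 * slopeDefect p κ u +
      ∫ x in Ioi (0 : ℝ), waveSlope p κ (u x) * |deriv u x| := by
  have i1 := hu.integrableOn_deriv_sq
  have i2 := hu.integrableOn_sq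
  have i3 := hu.integrableOn_rpow hp
  have i4 := integrableOn_waveSlope_mul hp hκ hu
  have h1 : slopeDefect p κ u = ∫ x in Ioi (0 : ℝ), (deriv u x ^ 2 +
      (κ ^ 2 * u x ^ 2 - 2 / p * |u x| ^ p) - 2 * (waveSlope p κ (u x) * |deriv u x|)) := by
    refine setIntegral_congr_fun measurableSet_Ioi fun x hx => ?_
    rw [← waveSlope_sq hp hκ (hb x (le_of_lt hx)), ← sq_abs (deriv u x)]
    ring
  have i5 : IntegrableOn (fun x => κ ^ 2 * u x ^ 2 - 2 / p * |u x| ^ p) (Ioi 0) :=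
    (i2.const_mul _).sub (i3.const_mul _)
  have i6 : IntegrableOn (fun x => deriv u x ^ 2 + (κ ^ 2 * u x ^ 2 - 2 / p * |u x| ^ p))
    (Ioi 0) := i1.add i5
  rw [integral_sub i6 (i4.const_mul 2), integral_add i1 i5,
    integral_sub (i2.const_mul _) (i3.const_mul _)] at h1
  simp only [integral_const_mul] at h1
  rw [h1, halfAction, nlsEnergy, mass]
  simp only [integral_Ici_eq_integral_Ioi]
  ring

lemma slopeDefect_nonneg : 0 ≤ slopeDefect p κ u :=
  integral_nonneg fun _ => sq_nonneg _

lemma ae_eq_of_slopeDefect_eq_zero (hp : 2 < p) (hκ : 0 < κ) (hu : MemH1 (Ici 0) u)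
    (h0 : slopeDefect p κ u = 0) :
    ∀ᵐ x, x ∈ Ioi (0 : ℝ) → |deriv u x| = waveSlope p κ (u x) := by
  have hm : AEStronglyMeasurable (fun x => |deriv u x| - waveSlope p κ (u x))
      (volume.restrict (Ioi 0)) :=
    (measurable_deriv u).norm.aestronglyMeasurable.sub
      ((continuous_waveSlope hp).comp_aestronglyMeasurable hu.aestronglyMeasurable)
  have hi : Integrable (fun x => (|deriv u x| - waveSlope p κ (u x)) ^ 2)
      (volume.restrict (Ioi 0)) := by
    refine ((hu.integrableOn_deriv_sq.const_mul 2).add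
      (hu.integrableOn_sq.const_mul (2 * κ ^ 2))).mono' (hm.pow 2)
      (Eventually.of_forall fun x => ?_)
    have h1 := waveSlope_le hp hκ (u x)
    have h2 := waveSlope_nonneg (p := p) (κ := κ) (u x)
    have h3 : waveSlope p κ (u x) ^ 2 ≤ κ ^ 2 * u x ^ 2 := by
      rw [← sq_abs (u x), ← mul_pow]; gcongr
    rw [Real.norm_of_nonneg (sq_nonneg _)]
    simp only [Pi.add_apply]
    nlinarith [sq_nonneg (|deriv u x| + waveSlope p κ (u x)), sq_abs (deriv u x)]
  rw [slopeDefect, integral_eq_zero_iff_of_nonneg (fun _ => sq_nonneg _) hi] at h0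
  rw [← ae_restrict_iff' measurableSet_Ioi]
  filter_upwards [h0] with x hx
  exact sub_eq_zero.1 (pow_eq_zero_iff two_ne_zero |>.1 hx)

lemma abs_slopePrimitive_sub_le (hp : 2 < p) (hu : MemH1 (Ici 0) u) {a b : ℝ} (ha : 0 ≤ a)
    (hab : a ≤ b) : |slopePrimitive p κ (u b) - slopePrimitive p κ (u a)| ≤
      ∫ x in a..b, waveSlope p κ (u x) * |deriv u x| := by
  have h1 := (hu.1 a ha b (ha.trans hab)).integral_comp_mul_deriv
    (contDiff_slopePrimitive (κ := κ) hp)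
  rw [← h1, deriv_slopePrimitive hp]
  refine (intervalIntegral.abs_integral_le_integral_abs hab).trans_eq ?_
  refine intervalIntegral.integral_congr fun x _ => ?_
  simp only [abs_mul, abs_of_nonneg (waveSlope_nonneg _)]

lemma tendsto_slopePrimitive (hp : 2 < p) (hu : MemH1 (Ici 0) u) :
    Tendsto (fun x => slopePrimitive p κ (u x)) atTop (𝓝 0) := by
  have h := ((contDiff_slopePrimitive (κ := κ) hp).continuous.tendsto 0).comp hu.tendsto_atTop
  rwa [slopePrimitive_zero] at h

lemma slopePrimitive_abs_le_integral (hp : 2 < p) (hκ : 0 < κ) (hu : MemH1 (Ici 0) u) {a : ℝ}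
    (ha : 0 ≤ a) : slopePrimitive p κ |u a| ≤
      ∫ x in Ioi a, waveSlope p κ (u x) * |deriv u x| := by
  have i4 := (integrableOn_waveSlope_mul hp hκ hu).mono_set (Ioi_subset_Ioi ha)
  have h1 := intervalIntegral_tendsto_integral_Ioi a i4 tendsto_id
  have h2 := ((tendsto_slopePrimitive (κ := κ) hp hu).sub_const (slopePrimitive p κ (u a))).abs
  rw [zero_sub, abs_neg, ← slopePrimitive_abs hp] at h2
  refine le_of_tendsto_of_tendsto h2 h1 ?_
  filter_upwards [eventually_ge_atTop a] with b hb
  exact abs_slopePrimitive_sub_le hp hu ha hb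

lemma setIntegral_Ioi_split {f : ℝ → ℝ} {a b : ℝ} (hf : IntegrableOn f (Ioi a)) (hab : a ≤ b) :
    ∫ x in Ioi a, f x = (∫ x in a..b, f x) + ∫ x in Ioi b, f x := by
  rw [intervalIntegral.integral_of_le hab, ← setIntegral_union Ioc_disjoint_Ioi_same
    measurableSet_Ioi (hf.mono_set Ioc_subset_Ioi_self) (hf.mono_set (Ioi_subset_Ioi hab)),
    Ioc_union_Ioi_eq_Ioi hab]

lemma le_halfAction (hp : 2 < p) (hκ : 0 < κ) (hu : MemH1 (Ici 0) u)
    (hb : ∀ x, 0 ≤ x → |u x| ≤ waveHeight p κ) :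
    1 / 2 * slopeDefect p κ u + slopePrimitive p κ |u 0| ≤ halfAction p κ u := by
  rw [halfAction_eq hp hκ hu hb]
  gcongr
  exact slopePrimitive_abs_le_integral hp hκ hu le_rfl

/-- The primitive of g along u must travel from its value at 0 to that at x₀, then to 0 at infinity.
-/
lemma le_halfAction_of_mem (hp : 2 < p) (hκ : 0 < κ) (hu : MemH1 (Ici 0) u)
    (hb : ∀ x, 0 ≤ x → |u x| ≤ waveHeight p κ) {x₀ : ℝ} (hx₀ : 0 ≤ x₀) :
    1 / 2 * slopeDefect p κ u + (2 * slopePrimitive p κ |u x₀| - slopePrimitive p κ |u 0|) ≤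
      halfAction p κ u := by
  rw [halfAction_eq hp hκ hu hb]
  gcongr
  rw [setIntegral_Ioi_split (integrableOn_waveSlope_mul hp hκ hu) hx₀]
  have h1 := slopePrimitive_abs_le_integral hp hκ hu hx₀
  have h2 := abs_slopePrimitive_sub_le (κ := κ) hp hu le_rfl hx₀
  have h3 := abs_sub_abs_le_abs_sub (slopePrimitive p κ (u x₀)) (slopePrimitive p κ (u 0))
  rw [← slopePrimitive_abs hp, ← slopePrimitive_abs hp] at h3
  linarith

/-- The equality case: no defect, and no variation lost when u rises up to x₀ and falls afterwards.
The guard 0 < x₀ admits waves already decreasing at 0, for which x₀ = 0. -/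
lemma halfAction_eq_of_unimodal (hp : 2 < p) (hκ : 0 < κ) (hu : MemH1 (Ici 0) u)
    (hb : ∀ x, 0 ≤ x → |u x| ≤ waveHeight p κ) {x₀ : ℝ} (hx₀ : 0 ≤ x₀)
    (hs : ∀ x, |deriv u x| = waveSlope p κ (u x))
    (h1 : 0 < x₀ → ∀ x, x ≤ x₀ → 0 ≤ deriv u x) (h2 : ∀ x, x₀ ≤ x → deriv u x ≤ 0) :
    halfAction p κ u = 2 * slopePrimitive p κ (u x₀) - slopePrimitive p κ (u 0) := by
  have i4 := integrableOn_waveSlope_mul hp hκ hu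
  have hd : slopeDefect p κ u = 0 := by simp [slopeDefect, hs]
  rw [halfAction_eq hp hκ hu hb, hd, setIntegral_Ioi_split i4 hx₀]
  have e1 : ∫ x in (0 : ℝ)..x₀, waveSlope p κ (u x) * |deriv u x| =
      slopePrimitive p κ (u x₀) - slopePrimitive p κ (u 0) := by
    rcases hx₀.eq_or_lt with rfl | hpos
    · simp
    rw [← (hu.1 0 self_mem_Ici x₀ hx₀).integral_comp_mul_deriv
      (contDiff_slopePrimitive (κ := κ) hp), deriv_slopePrimitive hp]
    refine intervalIntegral.integral_congr fun x hx => ?_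
    rw [uIcc_of_le hx₀] at hx
    simp only [abs_of_nonneg (h1 hpos x hx.2)]
  have e2 : ∫ x in Ioi x₀, waveSlope p κ (u x) * |deriv u x| = slopePrimitive p κ (u x₀) := by
    refine tendsto_nhds_unique (intervalIntegral_tendsto_integral_Ioi x₀
      (i4.mono_set (Ioi_subset_Ioi hx₀)) tendsto_id) ?_
    have h3 := (tendsto_slopePrimitive (κ := κ) hp hu).const_sub (slopePrimitive p κ (u x₀))
    rw [sub_zero] at h3
    refine h3.congr' ?_
    filter_upwards [eventually_ge_atTop x₀] with b hb'
    have h4 := (hu.1 x₀ hx₀ b (hx₀.trans hb')).integral_comp_mul_deriv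
      (contDiff_slopePrimitive (κ := κ) hp)
    rw [deriv_slopePrimitive hp] at h4
    rw [← neg_sub, ← h4, ← intervalIntegral.integral_neg]
    refine intervalIntegral.integral_congr fun x hx => ?_
    rw [uIcc_of_le hb'] at hx
    simp only [abs_of_nonpos (h2 x hx.1)]
    ring
  rw [e1, e2]; ring

lemma memH1_wave_half (hp : 2 < p) (hκ : 0 < κ) (y : ℝ) :
    MemH1 (Ici 0) fun x => wave p κ (y + x) := (memH1_wave hp hκ y).mono (subset_univ _)

lemma abs_wave_le (hp : 2 < p) (hκ : 0 < κ) (x : ℝ) : |wave p κ x| ≤ waveHeight p κ := by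
  rw [abs_of_pos (wave_pos hp hκ x)]; exact wave_le_waveHeight hp hκ x

lemma deriv_wave_nonneg (hp : 2 < p) (hκ : 0 < κ) {x : ℝ} (hx : x ≤ 0) :
    0 ≤ deriv (wave p κ) x := by
  have h := deriv_wave_nonpos hp hκ (neg_nonneg.2 hx)
  rw [deriv_wave hp] at h ⊢
  rw [wave_neg, mul_neg, Real.tanh_neg] at h
  linarith

lemma deriv_wave_add (p κ y x : ℝ) :
    deriv (fun x => wave p κ (y + x)) x = deriv (wave p κ) (y + x) :=
  deriv_comp_const_add _ _ _

lemma halfAction_wave (hp : 2 < p) (hκ : 0 < κ) (y : ℝ) :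
    halfAction p κ (fun x => wave p κ (y + x)) =
      2 * slopePrimitive p κ (wave p κ (max y 0)) - slopePrimitive p κ (wave p κ y) := by
  have hm : y + (max y 0 - y) = max y 0 := by ring
  rw [halfAction_eq_of_unimodal hp hκ (memH1_wave_half hp hκ y)
    (fun x _ => abs_wave_le hp hκ _) (sub_nonneg.2 (le_max_left y 0)) (fun x => ?_)
    (fun h x hx => ?_) fun x hx => ?_]
  · rw [hm, add_zero]
  · rw [deriv_wave_add, waveSlope_wave hp hκ]
  · rw [deriv_wave_add]
    have hy : y < 0 := by
      by_contra hy
      rw [max_eq_left (not_lt.1 hy), sub_self] at h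
      exact lt_irrefl _ h
    rw [max_eq_right hy.le] at hx
    exact deriv_wave_nonneg hp hκ (by linarith)
  · rw [deriv_wave_add]
    exact deriv_wave_nonpos hp hκ (by linarith [le_max_right y 0])

lemma halfAction_wave_of_nonneg (hp : 2 < p) (hκ : 0 < κ) {y : ℝ} (hy : 0 ≤ y) :
    halfAction p κ (fun x => wave p κ (y + x)) = slopePrimitive p κ (wave p κ y) := by
  rw [halfAction_wave hp hκ, max_eq_left hy]; ring

lemma halfAction_wave_of_nonpos (hp : 2 < p) (hκ : 0 < κ) {y : ℝ} (hy : y ≤ 0) :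
    halfAction p κ (fun x => wave p κ (y + x)) =
      2 * slopePrimitive p κ (waveHeight p κ) - slopePrimitive p κ (wave p κ y) := by
  rw [halfAction_wave hp hκ, max_eq_right hy, wave_zero]

end slope

/-! ### One-sided comparison with the waves -/

section comparison

variable {p κ : ℝ}

lemma waveSlope_eq_mul (hp : 2 < p) {s : ℝ} (hs : 0 ≤ s) :
    waveSlope p κ s = s * √(κ ^ 2 - 2 / p * s ^ (p - 2)) := by
  have h := abs_rpow_eq_mul hp s
  rw [abs_of_nonneg hs] at h
  rw [waveSlope, abs_of_nonneg hs, h, ← mul_assoc, ← sub_mul, Real.sqrt_mul' _ (sq_nonneg s),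
    Real.sqrt_sq hs, mul_comm]

/-- g(s) is s times a nonincreasing factor that is at most κ. Only increases are controlled: g has
unbounded negative slope just below the wave height. -/
lemma waveSlope_sub_le (hp : 2 < p) (hκ : 0 < κ) {s t : ℝ} (hs : 0 ≤ s) (hst : s ≤ t) :
    waveSlope p κ t - waveSlope p κ s ≤ κ * (t - s) := by
  rw [waveSlope_eq_mul hp hs, waveSlope_eq_mul hp (hs.trans hst)]
  have h1 : √(κ ^ 2 - 2 / p * t ^ (p - 2)) ≤ √(κ ^ 2 - 2 / p * s ^ (p - 2)) := by
    have : s ^ (p - 2) ≤ t ^ (p - 2) := Real.rpow_le_rpow hs hst (by linarith)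
    gcongr
  have h2 : √(κ ^ 2 - 2 / p * s ^ (p - 2)) ≤ κ := by
    refine Real.sqrt_le_iff.2 ⟨hκ.le, ?_⟩
    have : 0 ≤ 2 / p * s ^ (p - 2) := by positivity
    linarith
  nlinarith [mul_le_mul_of_nonneg_left h1 (hs.trans hst),
    mul_le_mul_of_nonneg_right h2 (sub_nonneg.2 hst)]

/-- Before a first contact, u' ≥ −g(u), w' = −g(w) and the one-sided bound give (u − w)' ≥ −κ(u −
w). Hence exp(κx)(u − w) cannot drop from a positive value to 0. -/
lemma wave_lt_of_slope_le (hp : 2 < p) (hκ : 0 < κ) {u : ℝ → ℝ} {a b z : ℝ} (hab : a ≤ b)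
    (hz : 0 ≤ z) (hu : AbsolutelyContinuousOnInterval u a b)
    (hae : ∀ᵐ x, x ∈ Ioc a b → |deriv u x| ≤ waveSlope p κ (u x)) (h0 : wave p κ z < u a) :
    wave p κ (z + (b - a)) < u b := by
  by_contra hcon
  have hφ : ContDiff ℝ 1 fun x => wave p κ (z - a + x) := (contDiff_wave p κ).comp (by fun_prop)
  have hd : AbsolutelyContinuousOnInterval (fun x => u x - wave p κ (z - a + x)) a b :=
    hu.sub hφ.contDiffOn.absolutelyContinuousOnInterval
  have hcont := hd.continuousOn
  rw [uIcc_of_le hab] at hcont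
  obtain ⟨c, ⟨hc, hc0⟩, hmin⟩ :
      ∃ c, IsLeast (Icc a b ∩ {x | u x - wave p κ (z - a + x) ≤ 0}) c := by
    refine IsCompact.exists_isLeast ?_ ⟨b, ⟨hab, le_rfl⟩, ?_⟩
    · exact isCompact_Icc.of_isClosed_subset
        (hcont.preimage_isClosed_of_isClosed isClosed_Icc isClosed_Iic) inter_subset_left
    · simp only [mem_ofPred_eq]
      rw [show z - a + b = z + (b - a) by ring]; linarith
  have hpos : ∀ x, a ≤ x → x < c → 0 < u x - wave p κ (z - a + x) := fun x hax hxc => by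
    by_contra h
    exact absurd (hmin ⟨⟨hax, hxc.le.trans hc.2⟩, not_lt.1 h⟩) (not_le.2 hxc)
  have hE : ContDiff ℝ 1 fun x => Real.exp (κ * x) := by fun_prop
  have hF : AbsolutelyContinuousOnInterval
      (fun x => Real.exp (κ * x) * (u x - wave p κ (z - a + x))) a c :=
    (hE.contDiffOn.absolutelyContinuousOnInterval.mul (hd.mono (uIcc_subset_uIcc left_mem_uIcc
      (by rw [uIcc_of_le hab]; exact hc))))
  have hint := hF.integral_deriv_eq_sub
  have hnn : 0 ≤ ∫ x in a..c,
      deriv (fun x => Real.exp (κ * x) * (u x - wave p κ (z - a + x))) x := by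
    rw [intervalIntegral.integral_of_le hc.1, ← integral_Ioc_eq_integral_Ioo.symm]
    refine setIntegral_nonneg_of_ae_restrict ?_
    have hdiff := hu.ae_differentiableAt
    rw [uIcc_of_le hab] at hdiff
    refine (ae_restrict_iff' measurableSet_Ioo).2 ?_
    filter_upwards [hdiff, hae] with x hx1 hx2 hx
    have hux := (hx1 ⟨hx.1.le, hx.2.le.trans hc.2⟩).hasDerivAt
    have hsl := hx2 ⟨hx.1, hx.2.le.trans hc.2⟩
    have hp1 := hpos x hx.1.le hx.2
    have hw : HasDerivAt (fun x => wave p κ (z - a + x)) (deriv (wave p κ) (z - a + x)) x :=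
      ((contDiff_wave p κ).differentiable one_ne_zero _).hasDerivAt.comp_const_add _ _
    have he : HasDerivAt (fun x => Real.exp (κ * x)) (Real.exp (κ * x) * κ) x := by
      simpa using ((hasDerivAt_id x).const_mul κ).exp
    have hder : HasDerivAt (fun x => Real.exp (κ * x) * (u x - wave p κ (z - a + x)))
        (Real.exp (κ * x) * κ * (u x - wave p κ (z - a + x)) +
          Real.exp (κ * x) * (deriv u x - deriv (wave p κ) (z - a + x))) x :=
      he.mul (hux.sub hw)
    rw [Pi.zero_apply, hder.deriv]
    have h1 := waveSlope_sub_le hp hκ (wave_pos hp hκ (z - a + x)).le (by linarith : _ ≤ u x)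
    rw [waveSlope_wave hp hκ,
      abs_of_nonpos (deriv_wave_nonpos hp hκ (by linarith [hx.1] : 0 ≤ z - a + x))] at h1
    have h2 := neg_le_of_abs_le hsl
    have h3 := Real.exp_pos (κ * x)
    rw [mul_assoc, ← mul_add]
    refine mul_nonneg h3.le ?_
    linarith
  rw [hint] at hnn
  have h1 : 0 < Real.exp (κ * a) * (u a - wave p κ (z - a + a)) := by
    rw [sub_add_cancel]; exact mul_pos (Real.exp_pos _) (by linarith)
  have h2 : Real.exp (κ * c) * (u c - wave p κ (z - a + c)) ≤ 0 :=
    mul_nonpos_of_nonneg_of_nonpos (Real.exp_pos _).le hc0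
  linarith

/-- Start the wave at z + ε, where it is strictly lower, and let ε tend to 0. -/
lemma wave_le_of_slope_le (hp : 2 < p) (hκ : 0 < κ) {u : ℝ → ℝ} {a b z : ℝ} (hab : a ≤ b)
    (hz : 0 ≤ z) (hu : AbsolutelyContinuousOnInterval u a b)
    (hae : ∀ᵐ x, x ∈ Ioc a b → |deriv u x| ≤ waveSlope p κ (u x)) (h0 : wave p κ z ≤ u a) :
    wave p κ (z + (b - a)) ≤ u b := by
  have h1 : Tendsto (fun ε => wave p κ (z + ε + (b - a))) (𝓝[>] 0)
      (𝓝 (wave p κ (z + 0 + (b - a)))) := by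
    refine Continuous.tendsto' ?_ 0 _ rfl |>.mono_left nhdsWithin_le_nhds
    exact (continuous_wave p κ).comp (by fun_prop)
  rw [add_zero] at h1
  refine le_of_tendsto h1 ?_
  filter_upwards [self_mem_nhdsWithin] with ε hε
  have hε' : (0 : ℝ) < ε := hε
  refine (wave_lt_of_slope_le hp hκ hab (by linarith) hu hae ?_).le
  refine lt_of_lt_of_le (wave_strictAntiOn hp hκ hz ?_ (by linarith)) h0
  exact mem_Ici.2 (by linarith)

lemma MemH1.wave_le (hp : 2 < p) (hκ : 0 < κ) {u : ℝ → ℝ} (hu : MemH1 (Ici 0) u)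
    (hae : ∀ᵐ x, x ∈ Ioi (0 : ℝ) → |deriv u x| = waveSlope p κ (u x)) {x₀ z : ℝ} (hx₀ : 0 ≤ x₀)
    (hz : 0 ≤ z) (h0 : wave p κ z ≤ u x₀) {x : ℝ} (hx : 0 ≤ x) :
    wave p κ (z + |x - x₀|) ≤ u x := by
  rcases le_total x₀ x with h | h
  · rw [abs_of_nonneg (sub_nonneg.2 h)]
    refine wave_le_of_slope_le hp hκ h hz (hu.1 x₀ hx₀ x hx) ?_ h0
    filter_upwards [hae] with y hy hy'
    exact (hy (hx₀.trans_lt hy'.1)).le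
  · rw [abs_of_nonpos (sub_nonpos.2 h), show -(x - x₀) = -x - -x₀ by ring]
    have h1 := wave_le_of_slope_le hp hκ (u := fun t => u (-t)) (neg_le_neg h) hz
      (hu.1 x₀ hx₀ x hx).comp_neg ?_ (by simpa using h0)
    · simpa using h1
    · have h2 := (Measure.measurePreserving_neg (volume : Measure ℝ)).quasiMeasurePreserving.ae hae
      -- The endpoint reflects to x, which may be 0, where the slope equation is not assumed.
      have h3 : ∀ᵐ y : ℝ, y ≠ -x := by simp [ae_iff]
      filter_upwards [h2, h3] with y hy hyx hy'
      rw [deriv_reflect, abs_neg]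
      have : y < -x := lt_of_le_of_ne hy'.2 hyx
      exact (hy (mem_Ioi.2 (by linarith))).le

end comparison

/-- The mass `∫_y^∞ φ²` of the standing wave of frequency `κ²` beyond `y`. -/
noncomputable def tailMass (p κ y : ℝ) : ℝ := ∫ x in Ioi y, wave p κ x ^ 2

/-! ### Mass of the waves and convexity in the frequency -/

section tailMass

variable {p κ : ℝ}

lemma integral_Ioi_wave_add (p κ y : ℝ) :
    ∫ x in Ioi (0 : ℝ), wave p κ (y + x) ^ 2 = tailMass p κ y := by
  have h := (measurePreserving_add_left volume y).setIntegral_preimage_emb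
    (measurableEmbedding_addLeft y) (fun x => wave p κ x ^ 2) (Ioi y)
  simpa [tailMass] using h

lemma tailMass_strictAnti (hp : 2 < p) (hκ : 0 < κ) : StrictAnti (tailMass p κ) := by
  intro y z hyz
  have hi := integrable_wave_sq hp hκ
  rw [tailMass, tailMass, setIntegral_Ioi_split (hi.integrableOn) hyz.le]
  have : 0 < ∫ x in y..z, wave p κ x ^ 2 :=
    intervalIntegral.intervalIntegral_pos_of_pos hi.intervalIntegrable
      (fun x => pow_pos (wave_pos hp hκ x) 2) hyz
  linarith

lemma tailMass_nonneg (y : ℝ) : 0 ≤ tailMass p κ y := integral_nonneg fun _ => sq_nonneg _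

lemma tailMass_pos (hp : 2 < p) (hκ : 0 < κ) (y : ℝ) : 0 < tailMass p κ y :=
  (tailMass_nonneg (y + 1)).trans_lt (tailMass_strictAnti hp hκ (lt_add_one y))

lemma integral_wave_sq (p κ : ℝ) : ∫ x, wave p κ x ^ 2 = 2 * tailMass p κ 0 := by
  rw [tailMass, ← integral_comp_abs]
  simp only [wave_abs]

lemma tailMass_neg_add (hp : 2 < p) (hκ : 0 < κ) (y : ℝ) :
    tailMass p κ (-y) + tailMass p κ y = 2 * tailMass p κ 0 := by
  have hi := integrable_wave_sq hp hκ
  have h1 : tailMass p κ (-y) = ∫ x in Iic y, wave p κ x ^ 2 := by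
    have := integral_comp_neg_Ioi (-y) (fun x => wave p κ x ^ 2)
    simpa only [wave_neg, neg_neg, tailMass] using this
  rw [h1, tailMass, ← integral_wave_sq, intervalIntegral.integral_Iic_add_Ioi hi.integrableOn
    hi.integrableOn]

lemma tailMass_eq_scale (hp : 2 < p) (hκ : 0 < κ) (y : ℝ) :
    tailMass p κ y = κ ^ (4 / (p - 2) - 1) * tailMass p 1 (κ * y) := by
  have h1 : ∀ x, wave p κ x ^ 2 = κ ^ (4 / (p - 2)) * wave p 1 (κ * x) ^ 2 := fun x => by
    rw [wave_eq_scale hp hκ, mul_pow, ← Real.rpow_natCast (κ ^ _), ← Real.rpow_mul hκ.le]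
    congr 2; push_cast; ring
  rw [tailMass, tailMass]
  simp only [h1]
  rw [integral_const_mul, integral_comp_mul_left_Ioi (fun x => wave p 1 x ^ 2) y hκ,
    Real.rpow_sub_one hκ.ne', smul_eq_mul]
  ring

/-- A virial identity: integrate the derivative of −w w' over the half-line. The left side enters
through ∫ w'² = G(A). -/
lemma slopePrimitive_waveHeight (hp : 2 < p) (hκ : 0 < κ) :
    (p + 2) * slopePrimitive p κ (waveHeight p κ) = (p - 2) * (κ ^ 2 * tailMass p κ 0) := by
  have hu := memH1_wave_half hp hκ 0
  simp only [zero_add] at hu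
  have i1 : IntegrableOn (fun x => wave p κ x ^ 2) (Ioi 0) := hu.integrableOn_sq
  have i2 : IntegrableOn (fun x => deriv (wave p κ) x ^ 2) (Ioi 0) := hu.integrableOn_deriv_sq
  have h0 : halfAction p κ (wave p κ) = slopePrimitive p κ (waveHeight p κ) := by
    simpa [wave_zero] using halfAction_wave_of_nonneg hp hκ le_rfl
  have hdef : slopeDefect p κ (wave p κ) = 0 := by simp [slopeDefect, waveSlope_wave hp hκ]
  rw [halfAction_eq hp hκ hu (fun x _ => abs_wave_le hp hκ _), hdef] at h0
  simp only [waveSlope_wave hp hκ, ← sq, sq_abs] at h0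
  have i3 : IntegrableOn (fun x => (p - 2) / 2 * (κ ^ 2 * wave p κ x ^ 2) -
    (p + 2) / 2 * deriv (wave p κ) x ^ 2) (Ioi 0) :=
    ((i1.const_mul _).const_mul _).sub (i2.const_mul _)
  have h1 := integral_Ioi_of_hasDerivAt_of_tendsto'
    -- This function is −w w'.
    (f := fun x => wave p κ x ^ 2 * (κ * Real.tanh ((p - 2) / 2 * κ * x)))
    (f' := fun x => (p - 2) / 2 * (κ ^ 2 * wave p κ x ^ 2) - (p + 2) / 2 * deriv (wave p κ) x ^ 2)
    (a := 0) (m := 0) ?_ i3 ?_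
  · rw [integral_sub ((i1.const_mul _).const_mul _) (i2.const_mul _)] at h1
    simp only [integral_const_mul] at h1
    rw [mul_zero, Real.tanh_zero] at h1
    rw [← h0, tailMass]
    linarith
  · intro x _
    have hc := Real.cosh_pos ((p - 2) / 2 * κ * x)
    have h2 : HasDerivAt (fun x => (p - 2) / 2 * κ * x) ((p - 2) / 2 * κ) x := by
      simpa using (hasDerivAt_id x).const_mul ((p - 2) / 2 * κ)
    have h3 := (h2.sinh.div h2.cosh hc.ne').const_mul κ
    have h4 := ((hasDerivAt_wave (κ := κ) hp x).pow 2).mul h3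
    simp only [Real.tanh_eq_sinh_div_cosh]
    refine h4.congr_deriv ?_
    rw [deriv_wave hp, Real.tanh_eq_sinh_div_cosh]
    simp only [Pi.pow_apply, Pi.div_apply]
    field_simp
    ring
  · have h2 : Tendsto (fun x => wave p κ x ^ 2 * κ) atTop (𝓝 0) := by
      simpa using ((tendsto_wave hp hκ).pow 2).mul_const κ
    refine squeeze_zero_norm (fun x => ?_) h2
    rw [norm_mul, norm_mul, Real.norm_of_nonneg (sq_nonneg _), Real.norm_of_nonneg hκ.le]
    have := (Real.abs_tanh_lt_one ((p - 2) / 2 * κ * x)).le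
    rw [Real.norm_eq_abs]
    gcongr
    exact mul_le_of_le_one_right hκ.le this

/-- A strict tangent line inequality in κ²: the quantity is a constant times (κ²)^β with β > 1, so
Bernoulli's inequality applies to the ratio κ'²/κ². -/
lemma slopePrimitive_waveHeight_lt (hp : 2 < p) (hp6 : p < 6) (hκ : 0 < κ) {κ' : ℝ}
    (hκ' : 0 < κ') (hne : κ' ≠ κ) :
    slopePrimitive p κ (waveHeight p κ) + tailMass p κ 0 / 2 * (κ' ^ 2 - κ ^ 2) <
      slopePrimitive p κ' (waveHeight p κ') := by
  have hp2 : 0 < p - 2 := by linarith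
  have key : ∀ k : ℝ, 0 < k → slopePrimitive p k (waveHeight p k) =
      (p - 2) / (p + 2) * tailMass p 1 0 * (k ^ 2) ^ ((p + 2) / (2 * (p - 2))) := fun k hk => by
    have h1 := slopePrimitive_waveHeight hp hk
    rw [tailMass_eq_scale hp hk, mul_zero] at h1
    have h2 : (k ^ 2) ^ ((p + 2) / (2 * (p - 2))) = k ^ 2 * k ^ (4 / (p - 2) - 1) := by
      rw [← Real.rpow_natCast k 2, ← Real.rpow_mul hk.le, ← Real.rpow_add hk]
      congr 1; push_cast; field_simp; ring
    rw [h2, div_mul_eq_mul_div, div_mul_eq_mul_div, eq_div_iff (by linarith)]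
    linarith
  set β := (p + 2) / (2 * (p - 2)) with hβ
  have hβ1 : 1 < β := by rw [hβ, lt_div_iff₀ (by positivity)]; linarith
  have hω : 0 < κ ^ 2 := by positivity
  have hs : κ' ^ 2 / κ ^ 2 - 1 ≠ 0 := by
    rw [sub_ne_zero, ne_eq, div_eq_one_iff_eq hω.ne']
    intro h
    exact hne ((pow_left_inj₀ hκ'.le hκ.le two_ne_zero).1 h)
  have hB := one_add_mul_self_lt_rpow_one_add
    (by linarith [div_pos (pow_pos hκ' 2) hω] : -1 ≤ κ' ^ 2 / κ ^ 2 - 1) hs hβ1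
  rw [add_sub_cancel, Real.div_rpow (by positivity) (by positivity), lt_div_iff₀ (by positivity)]
    at hB
  have hC : 0 < (p - 2) / (p + 2) * tailMass p 1 0 :=
    mul_pos (by positivity) (tailMass_pos hp one_pos 0)
  have h1 : tailMass p κ 0 / 2 * (κ' ^ 2 - κ ^ 2) =
      slopePrimitive p κ (waveHeight p κ) * (β * (κ' ^ 2 / κ ^ 2 - 1)) := by
    have := slopePrimitive_waveHeight hp hκ
    have h2 : slopePrimitive p κ (waveHeight p κ) = (p - 2) * (κ ^ 2 * tailMass p κ 0) / (p + 2) := by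
      field_simp; linarith
    rw [h2, hβ]
    field_simp
  rw [h1, key κ hκ, key κ' hκ']
  have := mul_lt_mul_of_pos_left hB hC
  linarith

lemma slopePrimitive_waveHeight_le (hp : 2 < p) (hp6 : p < 6) (hκ : 0 < κ) {κ' : ℝ}
    (hκ' : 0 < κ') :
    slopePrimitive p κ (waveHeight p κ) + tailMass p κ 0 / 2 * (κ' ^ 2 - κ ^ 2) ≤
      slopePrimitive p κ' (waveHeight p κ') := by
  rcases eq_or_ne κ' κ with rfl | h
  · simp
  · exact (slopePrimitive_waveHeight_lt hp hp6 hκ hκ' h).le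

end tailMass

/-! ### Minimizers on the half-line -/

section minimizers

variable {p κ : ℝ}

/-- The mass beyond z is strictly decreasing in z, so lying above the wave from z ≤ y with only the
mass beyond y forces z = y; then v² and w² have equal integrals. -/
lemma MemH1.eqOn_wave (hp : 2 < p) (hκ : 0 < κ) {v : ℝ → ℝ} (hv : MemH1 (Ici 0) v) {y z : ℝ}
    (hm : mass (Ici 0) v = tailMass p κ y) (hzy : z ≤ y)
    (hle : ∀ x, 0 ≤ x → wave p κ (z + x) ≤ v x) :
    EqOn v (fun x => wave p κ (y + x)) (Ici 0) := by
  have hw := memH1_wave_half hp hκ z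
  have hsq : ∀ x, 0 ≤ x → wave p κ (z + x) ^ 2 ≤ v x ^ 2 := fun x hx =>
    pow_le_pow_left₀ (wave_pos hp hκ _).le (hle x hx) 2
  rw [mass, integral_Ici_eq_integral_Ioi] at hm
  have h1 : tailMass p κ z ≤ tailMass p κ y := by
    rw [← hm, ← integral_Ioi_wave_add]
    exact setIntegral_mono_on hw.integrableOn_sq hv.integrableOn_sq measurableSet_Ioi
      fun x hx => hsq x (le_of_lt hx)
  obtain rfl : z = y := le_antisymm hzy ((tailMass_strictAnti hp hκ).le_iff_ge.1 h1)
  have h2 : ∫ x in Ioi (0 : ℝ), (v x ^ 2 - wave p κ (z + x) ^ 2) = 0 := by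
    rw [integral_sub hv.integrableOn_sq hw.integrableOn_sq, hm, integral_Ioi_wave_add, sub_self]
  have h3 := (setIntegral_eq_zero_iff_of_nonneg_ae
    ((ae_restrict_mem measurableSet_Ioi).mono fun x hx => sub_nonneg.2 (hsq x (le_of_lt hx)))
    (hv.integrableOn_sq.sub hw.integrableOn_sq)).1 h2
  refine Measure.eqOn_of_ae_eq (μ := volume) ?_ hv.continuousOn hw.continuousOn (by simp)
  rw [← Measure.restrict_congr_set Ioi_ae_eq_Ici]
  filter_upwards [h3, ae_restrict_mem measurableSet_Ioi] with x hx hx0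
  have hx0' : (0 : ℝ) ≤ x := le_of_lt hx0
  exact (pow_left_inj₀ ((wave_pos hp hκ _).le.trans (hle x hx0')) (wave_pos hp hκ _).le
    two_ne_zero).1 (sub_eq_zero.1 hx)

lemma MemH1.neg {u : ℝ → ℝ} {I : Set ℝ} (hu : MemH1 I u) : MemH1 I fun x => -u x := by
  refine ⟨fun b hb c hc => (hu.1 b hb c hc).neg, hu.2.neg, ?_⟩
  have : deriv (fun x => -u x) = -deriv u := by funext x; exact deriv.fun_neg
  rw [this]
  exact hu.3.neg

/-- Comparison from the peak puts v above the wave centred at x₀. The value at 0 gives −x₀ ≤ y, and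
the mass settles the rest. -/
lemma MemH1.eqOn_wave_of_peak (hp : 2 < p) (hκ : 0 < κ) {v : ℝ → ℝ} (hv : MemH1 (Ici 0) v)
    (hd : slopeDefect p κ v = 0) {x₀ y : ℝ} (hx₀ : 0 ≤ x₀) (hpk : |v x₀| = waveHeight p κ)
    (h0 : 0 < v 0) (hy : y ≤ 0) (hle : v 0 ≤ wave p κ y)
    (hm : mass (Ici 0) v = tailMass p κ y) :
    EqOn v (fun x => wave p κ (y + x)) (Ici 0) := by
  have hae := ae_eq_of_slopeDefect_eq_zero hp hκ hv hd
  have hx : v x₀ = waveHeight p κ := by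
    rcases abs_choice (v x₀) with h | h
    · rw [← h, hpk]
    -- A negative peak would put −v above a positive wave, against v(0) > 0.
    · exfalso
      have hae' : ∀ᵐ x, x ∈ Ioi (0 : ℝ) → |deriv (fun x => -v x) x| = waveSlope p κ (-v x) := by
        filter_upwards [hae] with x hx hx0
        rw [deriv.fun_neg, abs_neg, waveSlope_neg, hx hx0]
      have h1 := hv.neg.wave_le hp hκ hae' hx₀ le_rfl (by rw [wave_zero, ← hpk, h]) le_rfl
      have := wave_pos hp hκ (0 + |0 - x₀|)
      linarith
  have hcmp : ∀ x, 0 ≤ x → wave p κ (-x₀ + x) ≤ v x := fun x hx' => by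
    have := hv.wave_le hp hκ hae hx₀ le_rfl (by rw [wave_zero, hx]) hx'
    rwa [zero_add, wave_abs, sub_eq_neg_add] at this
  refine hv.eqOn_wave hp hκ hm ?_ hcmp
  have h1 := (hcmp 0 le_rfl).trans hle
  rw [add_zero, wave_le_wave_iff hp hκ, abs_of_nonpos hy, abs_neg, abs_of_nonneg hx₀] at h1
  linarith

lemma mass_wave (p κ y : ℝ) : mass (Ici 0) (fun x => wave p κ (y + x)) = tailMass p κ y := by
  rw [mass, integral_Ici_eq_integral_Ioi, integral_Ioi_wave_add]

/-- Test the lower bound of frequency κ' on the decreasing half-wave of frequency κ starting from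
|y|. -/
lemma slopePrimitive_wave_le (hp : 2 < p) (hκ : 0 < κ) {κ' y : ℝ} (hκ' : 0 < κ')
    (hy : wave p κ y ≤ waveHeight p κ') :
    slopePrimitive p κ' (wave p κ y) ≤
      slopePrimitive p κ (wave p κ y) + (κ' ^ 2 - κ ^ 2) / 2 * tailMass p κ |y| := by
  have h1 := le_halfAction hp hκ' (memH1_wave_half hp hκ |y|) fun x hx => by
    rw [abs_of_pos (wave_pos hp hκ _)]
    refine le_trans ((wave_le_wave_iff hp hκ).2 ?_) hy
    rw [abs_of_nonneg (by positivity : 0 ≤ |y| + x)]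
    linarith
  have h2 := halfAction_wave_of_nonneg hp hκ (abs_nonneg y)
  have h3 := slopeDefect_nonneg (p := p) (κ := κ') (u := fun x => wave p κ (|y| + x))
  rw [halfAction, mass_wave] at h1 h2
  rw [add_zero, abs_of_pos (wave_pos hp hκ _), wave_abs] at h1
  rw [wave_abs] at h2
  linarith

lemma nlsEnergy_wave (p κ y : ℝ) : nlsEnergy p (Ici 0) (fun x => wave p κ (y + x)) =
    halfAction p κ (fun x => wave p κ (y + x)) - κ ^ 2 / 2 * tailMass p κ y := by
  rw [halfAction, mass_wave]; ring

/-- Translates of standing waves minimize the energy on the half-line among the functions with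
the same mass and the same value at `0`, and they are the only minimizers. -/
lemma nlsEnergy_wave_le (hp : 2 < p) (hp6 : p < 6) (hκ : 0 < κ) {y : ℝ} {v : ℝ → ℝ}
    (hv : MemH1 (Ici 0) v) (hm : mass (Ici 0) v = tailMass p κ y) (h0 : v 0 = wave p κ y) :
    nlsEnergy p (Ici 0) (fun x => wave p κ (y + x)) ≤ nlsEnergy p (Ici 0) v ∧
      (nlsEnergy p (Ici 0) v ≤ nlsEnergy p (Ici 0) (fun x => wave p κ (y + x)) →
        EqOn v (fun x => wave p κ (y + x)) (Ici 0)) := by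
  obtain ⟨x₀, hx₀, hmax⟩ := hv.exists_forall_abs_le
  have hw := wave_pos hp hκ y
  have habs0 : |v 0| = wave p κ y := by rw [h0, abs_of_pos hw]
  have hA := hmax 0 le_rfl
  rw [habs0] at hA
  -- The frequency whose wave has height max |v|, so that v fits under it and peaks exactly at the
  -- top.
  obtain ⟨κ', hκ', hA'⟩ := exists_waveHeight_eq hp (hw.trans_le hA)
  have hb' : ∀ x, 0 ≤ x → |v x| ≤ waveHeight p κ' := by rw [hA']; exact hmax
  have l1 := le_halfAction_of_mem hp hκ' hv hb' hx₀
  have l2 := slopePrimitive_wave_le hp hκ hκ' (by rw [hA']; exact hA)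
  have hD' := slopeDefect_nonneg (p := p) (κ := κ') (u := v)
  rw [← hA', habs0, halfAction, hm] at l1
  rw [nlsEnergy_wave]
  rcases le_or_gt y 0 with hy | hy
  · have l3 := tailMass_neg_add hp hκ y
    rw [abs_of_nonpos hy] at l2
    rw [halfAction_wave_of_nonpos hp hκ hy]
    have l4 := slopePrimitive_waveHeight_le hp hp6 hκ hκ'
    have l5 : tailMass p κ (-y) = 2 * tailMass p κ 0 - tailMass p κ y := by linarith
    rw [l5] at l2
    refine ⟨by linarith, fun hE => ?_⟩
    obtain rfl : κ' = κ := by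
      by_contra hne
      have := slopePrimitive_waveHeight_lt hp hp6 hκ hκ' hne
      linarith
    exact hv.eqOn_wave_of_peak hp hκ (by linarith) hx₀ hA'.symm (h0 ▸ hw) hy h0.le hm
  · rw [halfAction_wave_of_nonneg hp hκ hy.le]
    rcases le_or_gt |v x₀| (waveHeight p κ) with hle | hlt
    · have l3 := le_halfAction hp hκ hv fun x hx => (hmax x hx).trans hle
      rw [habs0, halfAction, hm] at l3
      have hD := slopeDefect_nonneg (p := p) (κ := κ) (u := v)
      refine ⟨by linarith, fun hE => hv.eqOn_wave hp hκ hm le_rfl fun x hx => ?_⟩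
      have hae := ae_eq_of_slopeDefect_eq_zero hp hκ hv (by linarith)
      have := hv.wave_le hp hκ hae le_rfl hy.le h0.ge hx
      rwa [sub_zero, abs_of_nonneg hx] at this
    · have hκκ : κ < κ' := by
        by_contra hcon
        rcases (not_lt.1 hcon).eq_or_lt with h | h
        · rw [← hA', h] at hlt; exact lt_irrefl _ hlt
        · have := waveHeight_strictMono hp hκ' h
          rw [hA'] at this
          linarith
      have hΔ : 0 < κ' ^ 2 - κ ^ 2 := by
        have : κ ^ 2 < κ' ^ 2 := by gcongr
        linarith
      have l3 := slopePrimitive_waveHeight_lt hp hp6 hκ hκ' hκκ.ne'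
      have l4 := slopePrimitive_mono (κ := κ) hp (wave_le_waveHeight hp hκ y)
      rw [abs_of_pos hy] at l2
      -- Here the terms in κ'² − κ² do not cancel: the surplus (κ'² − κ²)(T(0) − T(y)) is positive,
      -- so exceeding the wave height is never optimal.
      have l5 := mul_pos hΔ (sub_pos.2 (tailMass_strictAnti hp hκ hy))
      have : slopePrimitive p κ (wave p κ y) - κ ^ 2 / 2 * tailMass p κ y <
        nlsEnergy p (Ici 0) v := by linarith
      exact ⟨this.le, fun h => absurd this (not_lt.2 h)⟩

lemma isHalfLineMinimizer_wave (hp : 2 < p) (hp6 : p < 6) (hκ : 0 < κ) (y : ℝ) :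
    IsHalfLineMinimizer p (tailMass p κ y) (wave p κ y) fun x => wave p κ (y + x) :=
  ⟨memH1_wave_half hp hκ y, mass_wave p κ y, by simp,
    fun _ hu hm h0 => (nlsEnergy_wave_le hp hp6 hκ hu hm h0).1⟩

lemma IsHalfLineMinimizer.eqOn_wave (hp : 2 < p) (hp6 : p < 6) (hκ : 0 < κ) {y : ℝ} {v : ℝ → ℝ}
    (hv : IsHalfLineMinimizer p (tailMass p κ y) (wave p κ y) v) :
    EqOn v (fun x => wave p κ (y + x)) (Ici 0) :=
  (nlsEnergy_wave_le hp hp6 hκ hv.memH1 hv.mass_eq hv.dirichlet).2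
    (hv.minimizes _ (memH1_wave_half hp hκ y) (mass_wave p κ y) (by simp))

/-! ### Minimizers on the whole line -/

lemma integral_eq_setIntegral_Ici_add {f : ℝ → ℝ} (h1 : IntegrableOn f (Ioi 0))
    (h2 : IntegrableOn (fun x => f (-x)) (Ioi 0)) :
    ∫ x in univ, f x = (∫ x in Ici 0, f x) + ∫ x in Ici 0, f (-x) := by
  have h3 : IntegrableOn f (Iic 0) := by
    have h := ((Measure.measurePreserving_neg (volume : Measure ℝ)).integrableOn_comp_preimage
      (Homeomorph.neg ℝ).measurableEmbedding (f := f) (s := Iio 0)).1 (by simpa [Function.comp_def] using h2)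
    exact (integrableOn_Iic_iff_integrableOn_Iio).2 h
  rw [integral_Ici_eq_integral_Ioi, integral_Ici_eq_integral_Ioi, integral_comp_neg_Ioi, neg_zero,
    setIntegral_univ, ← intervalIntegral.integral_Iic_add_Ioi h3 h1, add_comm]

lemma MemH1.mass_univ {u : ℝ → ℝ} (hu : MemH1 univ u) :
    mass univ u = mass (Ici 0) u + mass (Ici 0) fun x => u (-x) :=
  integral_eq_setIntegral_Ici_add (hu.mono (subset_univ _)).integrableOn_sq
    (hu.reflect.mono (subset_univ _)).integrableOn_sq

lemma MemH1.nlsEnergy_univ (hp : 2 < p) {u : ℝ → ℝ} (hu : MemH1 univ u) :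
    nlsEnergy p univ u = nlsEnergy p (Ici 0) u + nlsEnergy p (Ici 0) fun x => u (-x) := by
  have h1 := hu.mono (subset_univ (Ici 0))
  have h2 := hu.reflect.mono (subset_univ (Ici 0))
  have i2 := h2.integrableOn_deriv_sq
  simp only [deriv_reflect, neg_sq] at i2
  simp only [nlsEnergy, deriv_reflect, neg_sq]
  rw [integral_eq_setIntegral_Ici_add h1.integrableOn_deriv_sq i2,
    integral_eq_setIntegral_Ici_add (h1.integrableOn_rpow hp) (h2.integrableOn_rpow hp)]
  ring

lemma memH1_wave_univ (hp : 2 < p) (hκ : 0 < κ) : MemH1 univ (wave p κ) := by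
  simpa using memH1_wave hp hκ 0

lemma mass_univ_wave (p κ : ℝ) : mass univ (wave p κ) = 2 * tailMass p κ 0 := by
  rw [mass, setIntegral_univ, integral_wave_sq]

lemma nlsEnergy_univ_wave (hp : 2 < p) (hκ : 0 < κ) : nlsEnergy p univ (wave p κ) =
    2 * slopePrimitive p κ (waveHeight p κ) - κ ^ 2 * tailMass p κ 0 := by
  have h1 := nlsEnergy_wave p κ 0
  rw [halfAction_wave_of_nonneg hp hκ le_rfl, wave_zero] at h1
  simp only [zero_add] at h1
  rw [(memH1_wave_univ hp hκ).nlsEnergy_univ hp]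
  simp only [wave_neg]
  rw [h1]; ring

/-- Split at 0 and calibrate both halves by the global maximum. The half with the peak gives 2G(A')
− G(|u(0)|), the other G(|u(0)|); the boundary terms cancel. -/
lemma le_nlsEnergy_univ (hp : 2 < p) (hp6 : p < 6) (hκ : 0 < κ) {u : ℝ → ℝ} (hu : MemH1 univ u)
    (hm : mass univ u = 2 * tailMass p κ 0) :
    2 * slopePrimitive p κ (waveHeight p κ) - κ ^ 2 * tailMass p κ 0 ≤ nlsEnergy p univ u := by
  have h1 := hu.mono (subset_univ (Ici 0))
  have h2 := hu.reflect.mono (subset_univ (Ici 0))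
  obtain ⟨x₁, hx₁, hm₁⟩ := h1.exists_forall_abs_le
  obtain ⟨x₂, hx₂, hm₂⟩ := h2.exists_forall_abs_le
  wlog hle : |u (-x₂)| ≤ |u x₁| generalizing u x₁ x₂
  · have := this hu.reflect (by rw [hu.reflect.mass_univ, ← hm, hu.mass_univ]; simp [add_comm])
      h2 (by simpa using h1) x₂ hx₂ hm₂ x₁ hx₁ (by simpa using hm₁)
      (by simpa using (not_le.1 hle).le)
    rwa [hu.reflect.nlsEnergy_univ hp, add_comm, show (fun x => u (- -x)) = u by simp,
      ← hu.nlsEnergy_univ hp] at this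
  have hpos : 0 < |u x₁| := by
    refine lt_of_le_of_ne (abs_nonneg _) fun h0 => ?_
    have hz1 : ∀ x, 0 ≤ x → u x = 0 := fun x hx => abs_nonpos_iff.1 (h0 ▸ hm₁ x hx)
    have hz2 : ∀ x, 0 ≤ x → u (-x) = 0 := fun x hx =>
      abs_nonpos_iff.1 ((hm₂ x hx).trans (h0 ▸ hle))
    have hu0 : u = fun _ => 0 := by
      funext x
      rcases le_total 0 x with h | h
      · exact hz1 x h
      · simpa using hz2 (-x) (neg_nonneg.2 h)
    have := tailMass_pos hp hκ 0
    rw [hu0, mass] at hm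
    simp at hm
    linarith
  obtain ⟨κ', hκ', hA⟩ := exists_waveHeight_eq hp hpos
  have l1 := le_halfAction_of_mem hp hκ' h1 (by rw [hA]; exact hm₁) hx₁
  have l2 := le_halfAction hp hκ' h2 (by rw [hA]; exact fun x hx => (hm₂ x hx).trans hle)
  have l3 := slopePrimitive_waveHeight_le hp hp6 hκ hκ'
  have l4 := slopeDefect_nonneg (p := p) (κ := κ') (u := u)
  have l5 := slopeDefect_nonneg (p := p) (κ := κ') (u := fun x => u (-x))
  rw [hu.mass_univ] at hm
  rw [hu.nlsEnergy_univ hp]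
  rw [← hA, halfAction] at l1
  rw [neg_zero, halfAction] at l2
  have l6 : mass (Ici 0) u = 2 * tailMass p κ 0 - mass (Ici 0) fun x => u (-x) := by linarith
  rw [l6] at l1
  linarith

lemma isSoliton_wave (hp : 2 < p) (hp6 : p < 6) (hκ : 0 < κ) :
    IsSoliton p (2 * tailMass p κ 0) (wave p κ) :=
  ⟨memH1_wave_univ hp hκ, mass_univ_wave p κ, wave_pos hp hκ, wave_neg p κ, fun _ hu hm => by
    rw [nlsEnergy_univ_wave hp hκ]; exact le_nlsEnergy_univ hp hp6 hκ hu hm⟩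

/-- Evenness halves mass and energy, so the peak argument applies on the half-line with y = 0. The
peak is not assumed to be at 0. -/
lemma IsSoliton.eq_wave (hp : 2 < p) (hp6 : p < 6) (hκ : 0 < κ) {f : ℝ → ℝ}
    (hf : IsSoliton p (2 * tailMass p κ 0) f) : f = wave p κ := by
  have h1 := hf.memH1.mono (subset_univ (Ici 0))
  have hm := hf.memH1.mass_univ
  have hE := hf.memH1.nlsEnergy_univ hp
  have hmin := hf.minimizes _ (memH1_wave_univ hp hκ) (mass_univ_wave p κ)
  simp only [hf.even] at hm hE
  rw [hf.mass_eq] at hm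
  rw [nlsEnergy_univ_wave hp hκ, hE] at hmin
  have hm' : mass (Ici 0) f = tailMass p κ 0 := by linarith
  obtain ⟨x₀, hx₀, hmax⟩ := h1.exists_forall_abs_le
  obtain ⟨κ', hκ', hA⟩ := exists_waveHeight_eq hp (abs_pos.2 (hf.pos x₀).ne')
  have l1 := le_halfAction_of_mem hp hκ' h1 (by rw [hA]; exact hmax) hx₀
  have l2 := slopePrimitive_mono (κ := κ') hp (hmax 0 le_rfl)
  have l3 := slopePrimitive_waveHeight_le hp hp6 hκ hκ'
  have l4 := slopeDefect_nonneg (p := p) (κ := κ') (u := f)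
  rw [← hA] at l2
  rw [← hA, halfAction, hm'] at l1
  obtain rfl : κ' = κ := by
    by_contra hne
    have := slopePrimitive_waveHeight_lt hp hp6 hκ hκ' hne
    linarith
  have hle : f 0 ≤ wave p κ' 0 := by
    rw [wave_zero, hA]; exact (le_abs_self _).trans (hmax 0 le_rfl)
  have heq := h1.eqOn_wave_of_peak hp hκ (by linarith) hx₀ hA.symm (hf.pos 0) le_rfl hle hm'
  funext x
  rcases le_total 0 x with h | h
  · simpa using heq h
  · have := heq (neg_nonneg.2 h : 0 ≤ -x)
    simpa [hf.even, wave_neg] using this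

end minimizers

/-! ### Parametrization by boundary value and half-line mass -/

section parametrization

variable {p κ : ℝ}

/-- A standing wave and its position are determined by the value and the mass on the half-line,
since the translated wave is the only minimizer with these data. -/
lemma wave_params_unique (hp : 2 < p) (hp6 : p < 6) {κ₁ κ₂ y₁ y₂ : ℝ} (h1 : 0 < κ₁)
    (h2 : 0 < κ₂) (hw : wave p κ₁ y₁ = wave p κ₂ y₂) (ht : tailMass p κ₁ y₁ = tailMass p κ₂ y₂) :
    κ₁ = κ₂ ∧ y₁ = y₂ := by
  have hmin := isHalfLineMinimizer_wave hp hp6 h1 y₁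
  rw [hw, ht] at hmin
  have heq := hmin.eqOn_wave hp hp6 h2
  -- At the interior point 1 both waves share value and slope, and the first integral then
  -- determines κ².
  have hx : wave p κ₁ (y₁ + 1) = wave p κ₂ (y₂ + 1) := heq (zero_le_one : (0 : ℝ) ≤ 1)
  have hev : (fun x => wave p κ₁ (y₁ + x)) =ᶠ[𝓝 1] fun x => wave p κ₂ (y₂ + x) :=
    heq.eventuallyEq_of_mem (Ici_mem_nhds zero_lt_one)
  have hd := hev.deriv_eq
  rw [deriv_wave_add, deriv_wave_add] at hd
  have e1 := sq_sub_wave hp h1 (y₁ + 1)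
  have e2 := sq_sub_wave hp h2 (y₂ + 1)
  rw [hd, hx] at e1
  have hpos := wave_pos hp h2 (y₂ + 1)
  have e3 : κ₁ ^ 2 = κ₂ ^ 2 := mul_right_cancel₀ (pow_pos hpos 2).ne' (by linarith)
  obtain rfl := (pow_left_inj₀ h1.le h2.le two_ne_zero).1 e3
  exact ⟨rfl, (tailMass_strictAnti hp h1).injective ht⟩

lemma continuous_tailMass (hp : 2 < p) (hκ : 0 < κ) : Continuous (tailMass p κ) := by
  have hi := integrable_wave_sq hp hκ
  have h1 : tailMass p κ = fun y => tailMass p κ 0 - ∫ x in (0 : ℝ)..y, wave p κ x ^ 2 := by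
    funext y
    rcases le_total 0 y with h | h
    · rw [tailMass, tailMass, setIntegral_Ioi_split hi.integrableOn h]; ring
    · rw [tailMass, tailMass, setIntegral_Ioi_split (a := y) hi.integrableOn h,
        intervalIntegral.integral_symm y 0]; ring
  rw [h1]
  exact continuous_const.sub (intervalIntegral.continuous_primitive
    (fun _ _ => hi.intervalIntegrable) 0)

/-- The mass beyond `z` of the standing wave of frequency `1`, normalized by its value at `z` so
that it is invariant under scaling. -/
noncomputable def scaledMass (p z : ℝ) : ℝ := tailMass p 1 z / wave p 1 z ^ ((6 - p) / 2)

lemma tailMass_eq_scaledMass (hp : 2 < p) (hκ : 0 < κ) (y : ℝ) :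
    tailMass p κ y = wave p κ y ^ ((6 - p) / 2) * scaledMass p (κ * y) := by
  have hw := wave_pos hp one_pos (κ * y)
  have hp2 : p - 2 ≠ 0 := by linarith
  -- Mass scales as the power (6 − p)/2 of height, which explains the normalization.
  have he : κ ^ (4 / (p - 2) - 1) = (κ ^ (2 / (p - 2))) ^ ((6 - p) / 2) := by
    rw [← Real.rpow_mul hκ.le]; congr 1; field_simp; ring
  rw [tailMass_eq_scale hp hκ, wave_eq_scale hp hκ, scaledMass, he,
    Real.mul_rpow (by positivity) hw.le]
  field_simp

lemma exists_wave_eq (hp : 2 < p) {a : ℝ} (ha : 0 < a) (z : ℝ) :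
    ∃ κ y, 0 < κ ∧ κ * y = z ∧ wave p κ y = a ∧
      tailMass p κ y = a ^ ((6 - p) / 2) * scaledMass p z := by
  have hw := wave_pos hp one_pos z
  have hp2 : p - 2 ≠ 0 := by linarith
  have hκ : 0 < (a / wave p 1 z) ^ ((p - 2) / 2) := by positivity
  set κ := (a / wave p 1 z) ^ ((p - 2) / 2) with hκdef
  have h1 : κ * (z / κ) = z := by field_simp
  have h2 : wave p κ (z / κ) = a := by
    rw [wave_eq_scale hp hκ, h1, hκdef, ← Real.rpow_mul (by positivity),
      show (p - 2) / 2 * (2 / (p - 2)) = 1 by field_simp, Real.rpow_one]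
    field_simp
  exact ⟨κ, z / κ, hκ, h1, h2, by rw [tailMass_eq_scaledMass hp hκ, h1, h2]⟩

lemma continuous_scaledMass (hp : 2 < p) : Continuous (scaledMass p) := by
  refine (continuous_tailMass hp one_pos).div ?_
    fun z => (Real.rpow_pos_of_pos (wave_pos hp one_pos z) _).ne'
  exact (continuous_wave p 1).rpow_const fun z => Or.inl (wave_pos hp one_pos z).ne'

lemma scaledMass_pos (hp : 2 < p) (z : ℝ) : 0 < scaledMass p z :=
  div_pos (tailMass_pos hp one_pos z) (Real.rpow_pos_of_pos (wave_pos hp one_pos z) _)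

lemma scaledMass_injective (hp : 2 < p) (hp6 : p < 6) : Function.Injective (scaledMass p) := by
  intro z₁ z₂ h
  obtain ⟨κ₁, y₁, h1, hz1, hw1, ht1⟩ := exists_wave_eq hp one_pos z₁
  obtain ⟨κ₂, y₂, h2, hz2, hw2, ht2⟩ := exists_wave_eq hp one_pos z₂
  obtain ⟨rfl, rfl⟩ := wave_params_unique hp hp6 h1 h2 (hw1.trans hw2.symm)
    (by rw [ht1, ht2, h])
  exact hz1.symm.trans hz2

/-- For x > z ≥ 0, w(x)² ≤ w(x)^((p−2)/2) w(z)^((6−p)/2), which bounds the ratio by the tail of an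
integrable function. -/
lemma tendsto_scaledMass_atTop (hp : 2 < p) (hp6 : p < 6) :
    Tendsto (scaledMass p) atTop (𝓝 0) := by
  have hi : Integrable fun x => wave p 1 x ^ ((p - 2) / 2) :=
    integrable_wave_rpow hp one_pos (by linarith)
  have h1 : Tendsto (fun z => ∫ x in Ioi z, wave p 1 x ^ ((p - 2) / 2)) atTop (𝓝 0) := by
    have h2 := (intervalIntegral_tendsto_integral_Ioi 0 hi.integrableOn tendsto_id).const_sub
      (∫ x in Ioi (0 : ℝ), wave p 1 x ^ ((p - 2) / 2))
    rw [sub_self] at h2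
    refine h2.congr' ?_
    filter_upwards [eventually_ge_atTop 0] with z hz
    rw [setIntegral_Ioi_split hi.integrableOn hz, id]; ring
  refine squeeze_zero' (Eventually.of_forall fun z => (scaledMass_pos hp z).le) ?_ h1
  filter_upwards [eventually_ge_atTop 0] with z hz
  have hz' := wave_pos hp one_pos z
  rw [scaledMass, tailMass, ← integral_div]
  refine setIntegral_mono_on ((integrable_wave_sq hp one_pos).div_const _).integrableOn
    hi.integrableOn measurableSet_Ioi fun x hx => ?_
  have hx' := wave_pos hp one_pos x
  have hzx : z < x := hx
  have hle : wave p 1 x ≤ wave p 1 z := by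
    rw [wave_le_wave_iff hp one_pos, abs_of_nonneg hz, abs_of_nonneg (hz.trans hzx.le)]
    exact hzx.le
  rw [div_le_iff₀ (by positivity)]
  calc wave p 1 x ^ 2 = wave p 1 x ^ ((p - 2) / 2) * wave p 1 x ^ ((6 - p) / 2) := by
        rw [← Real.rpow_add hx', ← Real.rpow_natCast]; congr 1; push_cast; ring
    _ ≤ _ := by
        have : 0 ≤ (6 - p) / 2 := by linarith
        gcongr

/-- The mass stays above that of half the wave while the denominator tends to 0. -/
lemma tendsto_scaledMass_atBot (hp : 2 < p) (hp6 : p < 6) :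
    Tendsto (scaledMass p) atBot atTop := by
  have hw : Tendsto (wave p 1) atBot (𝓝 0) := by
    have := (tendsto_wave hp one_pos).comp tendsto_neg_atBot_atTop
    exact this.congr fun x => wave_neg p 1 x
  have he : 0 < (6 - p) / 2 := by linarith
  have h1 : Tendsto (fun z => wave p 1 z ^ ((6 - p) / 2)) atBot (𝓝[>] 0) := by
    refine tendsto_nhdsWithin_iff.2 ⟨?_, Eventually.of_forall fun z =>
      Real.rpow_pos_of_pos (wave_pos hp one_pos z) _⟩
    have := hw.rpow_const (p := (6 - p) / 2) (Or.inr he.le)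
    rwa [Real.zero_rpow he.ne'] at this
  refine tendsto_atTop_mono' _ ?_
    (h1.inv_tendsto_nhdsGT_zero.const_mul_atTop (tailMass_pos hp one_pos 0))
  filter_upwards [eventually_le_atBot 0] with z hz
  have := (tailMass_strictAnti hp one_pos).antitone hz
  have hz' := wave_pos hp one_pos z
  rw [scaledMass, div_eq_mul_inv]
  exact mul_le_mul_of_nonneg_right this (by rw [Pi.inv_apply]; positivity)

/-- Continuity and injectivity give strict monotonicity; a positive increasing function cannot tend
to 0 at infinity. -/
lemma scaledMass_strictAnti (hp : 2 < p) (hp6 : p < 6) : StrictAnti (scaledMass p) := by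
  refine ((continuous_scaledMass hp).strictMono_of_inj
    (scaledMass_injective hp hp6)).resolve_left fun hmono => ?_
  have h1 := (hmono.monotone).ge_of_tendsto (tendsto_scaledMass_atTop hp hp6) 0
  exact absurd h1 (not_le.2 (scaledMass_pos hp 0))

lemma exists_scaledMass_eq (hp : 2 < p) (hp6 : p < 6) {n : ℝ} (hn : 0 < n) :
    ∃ z, scaledMass p z = n := by
  obtain ⟨z₁, h1⟩ := ((tendsto_scaledMass_atTop hp hp6).eventually_le_const hn).exists
  obtain ⟨z₂, h2⟩ := ((tendsto_scaledMass_atBot hp hp6).eventually_ge_atTop n).exists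
  exact mem_range_of_exists_le_of_exists_ge (continuous_scaledMass hp) ⟨z₁, h1⟩ ⟨z₂, h2⟩

lemma exists_two_mul_tailMass_eq (hp : 2 < p) (hp6 : p < 6) {μ : ℝ} (hμ : 0 < μ) :
    ∃ κ, 0 < κ ∧ 2 * tailMass p κ 0 = μ := by
  have hT := tailMass_pos hp one_pos 0
  have he : 4 / (p - 2) - 1 ≠ 0 := by
    have : 0 < p - 2 := by linarith
    have : 1 < 4 / (p - 2) := by rw [lt_div_iff₀ this]; linarith
    linarith
  have hκ : 0 < (μ / (2 * tailMass p 1 0)) ^ (1 / (4 / (p - 2) - 1)) := by positivity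
  refine ⟨_, hκ, ?_⟩
  rw [tailMass_eq_scale hp hκ, ← Real.rpow_mul (by positivity), one_div_mul_cancel he,
    Real.rpow_one, mul_zero]
  field_simp

lemma isSoliton_iff_eq_wave (hp : 2 < p) (hp6 : p < 6) (hκ : 0 < κ) {f : ℝ → ℝ} :
    IsSoliton p (2 * tailMass p κ 0) f ↔ f = wave p κ :=
  ⟨fun h => h.eq_wave hp hp6 hκ, fun h => h ▸ isSoliton_wave hp hp6 hκ⟩

lemma soliton_eq_wave (hp : 2 < p) (hp6 : p < 6) (hκ : 0 < κ) :
    soliton p (2 * tailMass p κ 0) = wave p κ := by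
  have hex : ∃ f, IsSoliton p (2 * tailMass p κ 0) f := ⟨_, isSoliton_wave hp hp6 hκ⟩
  rw [soliton, dif_pos hex]
  exact hex.choose_spec.eq_wave hp hp6 hκ

end parametrization

theorem mainTheorem8 (p : ℝ) (hp2 : 2 < p) (hp6 : p < 6) :
    -- the soliton of each mass is well defined
    (∀ μ : ℝ, 0 < μ → ∀ f : ℝ → ℝ, IsSoliton p μ f ↔ f = soliton p μ) ∧
    ∀ a m : ℝ, 0 < a → 0 < m →
      ∃ M y : ℝ,
        -- existence of `M` and `y`
        (0 < M ∧ soliton p M y = a ∧ ∫ x in Ioi (0 : ℝ), (soliton p M (y + x)) ^ 2 = m / 2) ∧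
        -- uniqueness of `M` and `y`
        (∀ M' y' : ℝ, 0 < M' → soliton p M' y' = a →
          ∫ x in Ioi (0 : ℝ), (soliton p M' (y' + x)) ^ 2 = m / 2 → M' = M ∧ y' = y) ∧
        -- the unique solution of the double-constrained problem on the half-line
        IsHalfLineMinimizer p (m / 2) a (fun x => soliton p M (y + x)) ∧
        (∀ v : ℝ → ℝ, IsHalfLineMinimizer p (m / 2) a v →
          EqOn v (fun x => soliton p M (y + x)) (Ici 0)) ∧
        (soliton p m 0 < a ↔ 0 < y) := by
  refine ⟨fun μ hμ f => ?_, fun a m ha hm => ?_⟩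
  · obtain ⟨κ, hκ, rfl⟩ := exists_two_mul_tailMass_eq hp2 hp6 hμ
    rw [isSoliton_iff_eq_wave hp2 hp6 hκ, soliton_eq_wave hp2 hp6 hκ]
  have hγ : 0 < (6 - p) / 2 := by linarith
  obtain ⟨z, hz⟩ := exists_scaledMass_eq hp2 hp6
    (show 0 < m / 2 / a ^ ((6 - p) / 2) by positivity)
  obtain ⟨κ, y, hκ, rfl, rfl, ht⟩ := exists_wave_eq hp2 ha z
  rw [hz, mul_div_cancel₀ _ (by positivity)] at ht
  rw [← ht]
  refine ⟨2 * tailMass p κ 0, y, ?_, ?_, ?_, ?_, ?_⟩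
  · rw [soliton_eq_wave hp2 hp6 hκ]
    exact ⟨mul_pos two_pos (tailMass_pos hp2 hκ 0), rfl, integral_Ioi_wave_add p κ y⟩
  · intro M' y' hM' hw' ht'
    obtain ⟨κ', hκ', rfl⟩ := exists_two_mul_tailMass_eq hp2 hp6 hM'
    rw [soliton_eq_wave hp2 hp6 hκ'] at hw' ht'
    rw [integral_Ioi_wave_add] at ht'
    obtain ⟨rfl, rfl⟩ := wave_params_unique hp2 hp6 hκ' hκ hw' ht'
    exact ⟨rfl, rfl⟩
  · rw [soliton_eq_wave hp2 hp6 hκ]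
    exact isHalfLineMinimizer_wave hp2 hp6 hκ y
  · rw [soliton_eq_wave hp2 hp6 hκ]
    exact fun v hv => hv.eqOn_wave hp2 hp6 hκ
  · obtain ⟨κ', hκ', rfl⟩ := exists_two_mul_tailMass_eq hp2 hp6 hm
    rw [soliton_eq_wave hp2 hp6 hκ']
    have h1 : tailMass p κ y = tailMass p κ' 0 := by linarith
    -- Both masses are m/2, so with γ = (6 − p)/2 and N = `scaledMass p`, a^γ N(κy) = φ_m(0)^γ N(0):
    -- the larger value goes with the smaller N.
    rw [tailMass_eq_scaledMass hp2 hκ, tailMass_eq_scaledMass hp2 hκ', mul_zero] at h1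
    have hA := wave_pos hp2 hκ' 0
    have p1 := scaledMass_pos hp2 (κ * y)
    have p2 := scaledMass_pos hp2 0
    have e1 : 0 < y ↔ scaledMass p (κ * y) < scaledMass p 0 := by
      rw [(scaledMass_strictAnti hp2 hp6).lt_iff_gt, mul_pos_iff_of_pos_left hκ]
    rw [e1, ← Real.rpow_lt_rpow_iff hA.le ha.le hγ]
    have q1 : 0 < wave p κ y ^ ((6 - p) / 2) := by positivity
    constructor
    · intro h
      by_contra hcon
      nlinarith [mul_lt_mul_of_pos_right h p2, mul_le_mul_of_nonneg_left (not_lt.1 hcon) q1.le]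
    · intro h
      by_contra hcon
      nlinarith [mul_lt_mul_of_pos_left h q1, mul_le_mul_of_nonneg_right (not_lt.1 hcon) p2.le]
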